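/- Let $k$ be a field and let $C$ be a basic $k$-coalgebra, i.e. the socle of $C$ as a right comodule is a direct sum $\bigoplus_{i\in I_C} S_i$ of pairwise non-isomorphic simple right comodules; the subspaces $S_i\subseteq C$ then form a complete set of pairwise non-isomorphic simple right $C$-comodules. The right valued Gabriel quiver $Q_C$ has the simple right $C$-comodules $S_i$, $i\in I_C$, as vertices, and for simple right $C$-comodules $T,S$ there is a (unique) valued arrow $T\xrightarrow{(c,d)}S$ if and only if $\operatorname{Ext}^1_C(T,S)\neq 0$, where $c$ is the dimension of $\operatorname{Ext}^1_C(T,S)$ as a right $\operatorname{End}_C(T)$-module and $d$ is its dimension as a left $\operatorname{End}_C(S)$-module (dimensions are cardinal numbers). For a subcoalgebra $E\subseteq C$ the quiver $Q_E$ is defined in the same way from the coalgebra $E$, and its vertices, the simple right $E$-comodules contained in $E$, are regarded as subspaces of $C$. Let $A$ and $B$ be subcoalgebras of $C$, and let $A\wedge B=\{x\in C:\Delta(x)\in A\otimes C+C\otimes B\}=\ker\bigl(C\xrightarrow{\Delta}C\otimes C\to C/A\otimes C/B\bigr)$, which is again a subcoalgebra of $C$. Theorem. (1) The set of vertices of $Q_{A\wedge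 B}$ is the union of the sets of vertices of $Q_A$ and $Q_B$. Here $Q_A$ and $Q_B$ are viewed inside $Q_C$: for $E\in\{A,B\}$, every vertex of $Q_E$ is a vertex of $Q_C$, and if there is an arrow $T\xrightarrow{(c,d)}S$ in $Q_E$, then there is an arrow $T\xrightarrow{(c',d')}S$ in $Q_C$ with $c\le c'$ and $d\le d'$. (2) Let $S$ and $T$ be two vertices of $Q_{A\wedge B}$, that is, simple right $A\wedge B$-comodules. (i) If $S\not\subseteq A$ and $T\not\subseteq B$, there is no arrow from $T$ to $S$ in $Q_{A\wedge B}$. (ii) If $S\subseteq A$ and $T\subseteq B$, there is an arrow $T\xrightarrow{(c,d)}S$ in $Q_{A\wedge B}$ if and only if there is an arrow $T\xrightarrow{(c,d)}S$ in $Q_C$. (iii) If $S\subseteq A$ and $T\not\subseteq B$, there is an arrow $T\xrightarrow{(c,d)}S$ in $Q_{A\wedge B}$ if and only if there is an arrow $T\xrightarrow{(c,d)}S$ in $Q_A$. (iv) If $S\not\subseteq A$ and $T\subseteq B$, there is an arrow $T\xrightarrow{(c,d)}S$ in $Q_{A\wedge B}$ if and only if there is an arrow $T\xrightarrow{(c,d)}S$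 in $Q_B$. -/

import Mathlib

open scoped TensorProduct

universe u v

section MiddleCohomology

variable {k X Y Z : Type*} [Field k] [AddCommGroup X] [Module k X] [AddCommGroup Y] [Module k Y]
  [AddCommGroup Z] [Module k Z]

/-- The cohomology `ker d₁ / im d₀` of a complex `X → Y → Z`. -/
def MiddleCohomology (d₀ : X →ₗ[k] Y) (d₁ : Y →ₗ[k] Z) :=
  LinearMap.ker d₁ ⧸ (LinearMap.range d₀).submoduleOf (LinearMap.ker d₁)

noncomputable instance (d₀ : X →ₗ[k] Y) (d₁ : Y →ₗ[k] Z) :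
    AddCommGroup (MiddleCohomology d₀ d₁) :=
  inferInstanceAs (AddCommGroup
    (LinearMap.ker d₁ ⧸ (LinearMap.range d₀).submoduleOf (LinearMap.ker d₁)))

noncomputable instance (d₀ : X →ₗ[k] Y) (d₁ : Y →ₗ[k] Z) : Module k (MiddleCohomology d₀ d₁) :=
  inferInstanceAs (Module k
    (LinearMap.ker d₁ ⧸ (LinearMap.range d₀).submoduleOf (LinearMap.ker d₁)))

/-- The class of a cocycle. -/
noncomputable def MiddleCohomology.mk (d₀ : X →ₗ[k] Y) (d₁ : Y →ₗ[k] Z) :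
    LinearMap.ker d₁ →ₗ[k] MiddleCohomology d₀ d₁ :=
  Submodule.mkQ _

/-- A linear map on cochains which preserves cocycles and coboundaries acts on cohomology. -/
noncomputable def MiddleCohomology.induced (d₀ : X →ₗ[k] Y) (d₁ : Y →ₗ[k] Z) (φ : Y →ₗ[k] Y)
    (hZ : ∀ f ∈ LinearMap.ker d₁, φ f ∈ LinearMap.ker d₁)
    (hB : ∀ f ∈ LinearMap.range d₀, φ f ∈ LinearMap.range d₀) :
    Module.End k (MiddleCohomology d₀ d₁) :=
  Submodule.mapQ _ _ (φ.restrict hZ) (fun f hf => hB f.1 hf)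

theorem MiddleCohomology.mk_surjective (d₀ : X →ₗ[k] Y) (d₁ : Y →ₗ[k] Z) :
    Function.Surjective (MiddleCohomology.mk d₀ d₁) :=
  Submodule.mkQ_surjective _

end MiddleCohomology

/-- Right comodules over a `k`-coalgebra `C`: a coaction `M → M ⊗ C` which is coassociative and
counital. -/
structure RightComodule (k : Type u) (C : Type v) (M : Type v) [Field k]
    [AddCommGroup C] [Module k C] [Coalgebra k C] [AddCommGroup M] [Module k M] where
  /-- the coaction -/
  coact : M →ₗ[k] M ⊗[k] C
  coassoc : (TensorProduct.assoc k M C C).toLinearMap ∘ₗ coact.rTensor C ∘ₗ coact =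
    (Coalgebra.comul (R := k) (A := C)).lTensor M ∘ₗ coact
  counit_coact : (Coalgebra.counit (R := k) (A := C)).lTensor M ∘ₗ coact =
    (TensorProduct.mk k M k).flip 1

namespace RightComodule

section General

variable {k : Type u} {C M N P : Type v} [Field k] [AddCommGroup C] [Module k C] [Coalgebra k C]
  [AddCommGroup M] [Module k M] [AddCommGroup N] [Module k N] [AddCommGroup P] [Module k P]

/-- `f : M → N` is a morphism of right comodules. -/
def IsHom (ρM : RightComodule k C M) (ρN : RightComodule k C N) (f : M →ₗ[k] N) : Prop :=
  ρN.coact ∘ₗ f = f.rTensor C ∘ₗ ρM.coact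

/-- Isomorphism of right comodules. -/
def Iso (ρM : RightComodule k C M) (ρN : RightComodule k C N) : Prop :=
  ∃ e : M ≃ₗ[k] N, IsHom ρM ρN e.toLinearMap

/-- A subspace `W ⊆ M` with `ρ(W) ⊆ W ⊗ C`. -/
def IsSubcomodule (ρ : RightComodule k C M) (W : Submodule k M) : Prop :=
  ∀ w ∈ W, ρ.coact w ∈ LinearMap.range (W.subtype.rTensor C)

theorem rTensor_subtype_injective (C : Type*) [AddCommGroup C] [Module k C]
    (W : Submodule k M) : Function.Injective (W.subtype.rTensor C) :=
  Module.Flat.rTensor_preserves_injective_linearMap _ W.injective_subtype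

/-- The coaction `W → W ⊗ C` of a subcomodule `W`. -/
noncomputable def subCoact (ρ : RightComodule k C M) (W : Submodule k M)
    (h : ρ.IsSubcomodule W) : W →ₗ[k] W ⊗[k] C :=
  (LinearEquiv.ofInjective _ (rTensor_subtype_injective C W)).symm.toLinearMap ∘ₗ
    (ρ.coact ∘ₗ W.subtype).codRestrict _ (fun w => h w w.2)

theorem subtype_comp_subCoact (ρ : RightComodule k C M) (W : Submodule k M)
    (h : ρ.IsSubcomodule W) :
    W.subtype.rTensor C ∘ₗ ρ.subCoact W h = ρ.coact ∘ₗ W.subtype := by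
  ext w
  have := LinearEquiv.apply_symm_apply
    (LinearEquiv.ofInjective _ (rTensor_subtype_injective C W)) ⟨ρ.coact w, h w w.2⟩
  exact congrArg Subtype.val this

/-- A subcomodule with its induced structure of right comodule. -/
noncomputable def restrict (ρ : RightComodule k C M) (W : Submodule k M)
    (h : ρ.IsSubcomodule W) : RightComodule k C W where
  coact := ρ.subCoact W h
  coassoc := by
    have key := ρ.subtype_comp_subCoact W h
    have inj : Function.Injective (W.subtype.rTensor (C ⊗[k] C)) :=
      rTensor_subtype_injective _ W
    have nat1 : W.subtype.rTensor (C ⊗[k] C) ∘ₗ (TensorProduct.assoc k W C C).toLinearMap =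
        (TensorProduct.assoc k M C C).toLinearMap ∘ₗ (W.subtype.rTensor C).rTensor C := by
      ext; rfl
    have nat2 : W.subtype.rTensor (C ⊗[k] C) ∘ₗ
        (Coalgebra.comul (R := k) (A := C)).lTensor W =
        (Coalgebra.comul (R := k) (A := C)).lTensor M ∘ₗ W.subtype.rTensor C := by
      ext; rfl
    have e : W.subtype.rTensor (C ⊗[k] C) ∘ₗ ((TensorProduct.assoc k W C C).toLinearMap ∘ₗ
        (ρ.subCoact W h).rTensor C ∘ₗ ρ.subCoact W h) =
        W.subtype.rTensor (C ⊗[k] C) ∘ₗ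
        ((Coalgebra.comul (R := k) (A := C)).lTensor W ∘ₗ ρ.subCoact W h) := by
      rw [← LinearMap.comp_assoc, nat1, ← LinearMap.comp_assoc _ _ (W.subtype.rTensor _), nat2,
        LinearMap.comp_assoc, ← LinearMap.comp_assoc _ _ ((W.subtype.rTensor C).rTensor C),
        ← LinearMap.rTensor_comp, key, LinearMap.rTensor_comp, LinearMap.comp_assoc, key,
        LinearMap.comp_assoc, key, ← LinearMap.comp_assoc, ← LinearMap.comp_assoc,
        ← LinearMap.comp_assoc, LinearMap.comp_assoc _ _ (TensorProduct.assoc k M C C).toLinearMap,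
        ρ.coassoc]
    exact LinearMap.ext fun w => inj (LinearMap.congr_fun e w)
  counit_coact := by
    have key := ρ.subtype_comp_subCoact W h
    have inj : Function.Injective (W.subtype.rTensor k) := rTensor_subtype_injective _ W
    have nat2 : W.subtype.rTensor k ∘ₗ
        (Coalgebra.counit (R := k) (A := C)).lTensor W =
        (Coalgebra.counit (R := k) (A := C)).lTensor M ∘ₗ W.subtype.rTensor C := by
      ext; rfl
    have e : W.subtype.rTensor k ∘ₗ ((Coalgebra.counit (R := k) (A := C)).lTensor W ∘ₗ
        ρ.subCoact W h) = W.subtype.rTensor k ∘ₗ (TensorProduct.mk k W k).flip 1 := by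
      rw [← LinearMap.comp_assoc, nat2, LinearMap.comp_assoc, key, ← LinearMap.comp_assoc,
        ρ.counit_coact]
      rfl
    exact LinearMap.ext fun w => inj (LinearMap.congr_fun e w)

/-- Simple right comodules: nonzero, without proper nonzero subcomodules. -/
def IsSimple (ρ : RightComodule k C M) : Prop :=
  Nontrivial M ∧ ∀ W : Submodule k M, ρ.IsSubcomodule W → W = ⊥ ∨ W = ⊤

/-- The algebra `End_C(M)` of comodule endomorphisms, with composition as product. -/
def endAlgebra (ρ : RightComodule k C M) : Subalgebra k (Module.End k M) where
  carrier := {f | IsHom ρ ρ f}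
  mul_mem' := by
    intro f g hf hg
    simp only [Set.mem_ofPred_eq, IsHom, Module.End.mul_eq_comp] at *
    rw [← LinearMap.comp_assoc, hf, LinearMap.comp_assoc, hg, LinearMap.rTensor_comp,
      LinearMap.comp_assoc]
  add_mem' := by
    intro f g hf hg
    simp only [Set.mem_ofPred_eq, IsHom] at *
    rw [LinearMap.comp_add, hf, hg, LinearMap.rTensor_add, LinearMap.add_comp]
  algebraMap_mem' := by
    intro r
    simp only [Set.mem_ofPred_eq, IsHom, Module.algebraMap_end_eq_smul_id,
      LinearMap.rTensor_smul, LinearMap.rTensor_id, LinearMap.comp_smul, LinearMap.smul_comp,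
      LinearMap.comp_id, LinearMap.id_comp]

/-- Postcomposition with `b ⊗ id_C`. -/
noncomputable def post (C : Type v) [AddCommGroup C] [Module k C] (b : N →ₗ[k] P) :
    (M →ₗ[k] N ⊗[k] C) →ₗ[k] (M →ₗ[k] P ⊗[k] C) :=
  LinearMap.llcomp k M (N ⊗[k] C) (P ⊗[k] C) (b.rTensor C)

/-- Precomposition with `a`. -/
noncomputable def pre (a : M →ₗ[k] N) : (N →ₗ[k] P) →ₗ[k] (M →ₗ[k] P) :=
  LinearMap.lcomp k P a

/-- The differential `Hom_k(T, S) → Hom_k(T, S ⊗ C)`, `g ↦ ρ_S g - (g ⊗ id) ρ_T`. -/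
noncomputable def d₀ (ρT : RightComodule k C M) (ρS : RightComodule k C N) :
    (M →ₗ[k] N) →ₗ[k] (M →ₗ[k] N ⊗[k] C) where
  toFun g := ρS.coact ∘ₗ g - g.rTensor C ∘ₗ ρT.coact
  map_add' g h := by
    simp only [LinearMap.comp_add, LinearMap.rTensor_add, LinearMap.add_comp]; abel
  map_smul' r g := by
    simp only [LinearMap.comp_smul, LinearMap.rTensor_smul, LinearMap.smul_comp, smul_sub,
      RingHom.id_apply]

/-- The differential `Hom_k(T, S ⊗ C) → Hom_k(T, S ⊗ C ⊗ C)`,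
`f ↦ (ρ_S ⊗ id) f - (id ⊗ Δ) f + (f ⊗ id) ρ_T`. -/
noncomputable def d₁ (ρT : RightComodule k C M) (ρS : RightComodule k C N) :
    (M →ₗ[k] N ⊗[k] C) →ₗ[k] (M →ₗ[k] N ⊗[k] (C ⊗[k] C)) where
  toFun f := (TensorProduct.assoc k N C C).toLinearMap ∘ₗ ρS.coact.rTensor C ∘ₗ f
    - (Coalgebra.comul (R := k) (A := C)).lTensor N ∘ₗ f
    + (TensorProduct.assoc k N C C).toLinearMap ∘ₗ f.rTensor C ∘ₗ ρT.coact
  map_add' g h := by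
    simp only [LinearMap.comp_add, LinearMap.rTensor_add, LinearMap.add_comp]; abel
  map_smul' r g := by
    simp only [LinearMap.comp_smul, LinearMap.rTensor_smul, LinearMap.smul_comp, smul_sub,
      smul_add, RingHom.id_apply]

theorem d₁_d₀ (ρT : RightComodule k C M) (ρS : RightComodule k C N) (g : M →ₗ[k] N) :
    d₁ ρT ρS (d₀ ρT ρS g) = 0 := by
  have nat1 : (TensorProduct.assoc k N C C).toLinearMap ∘ₗ (g.rTensor C).rTensor C =
      g.rTensor (C ⊗[k] C) ∘ₗ (TensorProduct.assoc k M C C).toLinearMap := by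
    ext; rfl
  have nat2 : (Coalgebra.comul (R := k) (A := C)).lTensor N ∘ₗ g.rTensor C =
      g.rTensor (C ⊗[k] C) ∘ₗ (Coalgebra.comul (R := k) (A := C)).lTensor M := by
    ext; rfl
  have hS := congrArg (fun f => f ∘ₗ g) ρS.coassoc
  have hT := congrArg (fun f => g.rTensor (C ⊗[k] C) ∘ₗ f) ρT.coassoc
  simp only [← LinearMap.comp_assoc] at hS hT
  rw [← nat1, ← nat2] at hT
  simp only [d₁, d₀, LinearMap.coe_mk, AddHom.coe_mk, LinearMap.comp_sub, LinearMap.sub_comp,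
    LinearMap.rTensor_sub, LinearMap.rTensor_comp, ← LinearMap.comp_assoc, hS, hT]
  abel

theorem d₀_post (ρT : RightComodule k C M) {ρS : RightComodule k C N} {ρU : RightComodule k C P}
    {b : N →ₗ[k] P} (hb : IsHom ρS ρU b) (g : M →ₗ[k] N) :
    d₀ ρT ρU (b ∘ₗ g) = post C b (d₀ ρT ρS g) := by
  have hb' : ρU.coact ∘ₗ b = b.rTensor C ∘ₗ ρS.coact := hb
  simp only [d₀, post, LinearMap.coe_mk, AddHom.coe_mk, LinearMap.llcomp_apply',
    LinearMap.comp_sub, LinearMap.rTensor_comp, ← LinearMap.comp_assoc, hb']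

theorem d₁_post (ρT : RightComodule k C M) {ρS : RightComodule k C N} {ρU : RightComodule k C P}
    {b : N →ₗ[k] P} (hb : IsHom ρS ρU b) (f : M →ₗ[k] N ⊗[k] C) :
    d₁ ρT ρU (post C b f) = b.rTensor (C ⊗[k] C) ∘ₗ d₁ ρT ρS f := by
  have hb' : ρU.coact ∘ₗ b = b.rTensor C ∘ₗ ρS.coact := hb
  have nat1 : (TensorProduct.assoc k P C C).toLinearMap ∘ₗ (b.rTensor C).rTensor C =
      b.rTensor (C ⊗[k] C) ∘ₗ (TensorProduct.assoc k N C C).toLinearMap := by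
    ext; rfl
  have nat2 : (Coalgebra.comul (R := k) (A := C)).lTensor P ∘ₗ b.rTensor C =
      b.rTensor (C ⊗[k] C) ∘ₗ (Coalgebra.comul (R := k) (A := C)).lTensor N := by
    ext; rfl
  have h3 : ρU.coact.rTensor C ∘ₗ b.rTensor C =
      (b.rTensor C).rTensor C ∘ₗ ρS.coact.rTensor C := by
    rw [← LinearMap.rTensor_comp, hb', LinearMap.rTensor_comp]
  simp only [d₁, post, LinearMap.coe_mk, AddHom.coe_mk, LinearMap.llcomp_apply',
    LinearMap.comp_sub, LinearMap.comp_add, LinearMap.rTensor_comp, ← LinearMap.comp_assoc,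
    nat2, ← nat1]
  simp only [LinearMap.comp_assoc]
  rw [← LinearMap.comp_assoc _ (b.rTensor C) (ρU.coact.rTensor C), h3]
  simp only [LinearMap.comp_assoc]

theorem d₀_pre {ρT : RightComodule k C M} {ρU : RightComodule k C P} (ρS : RightComodule k C N)
    {a : P →ₗ[k] M} (ha : IsHom ρU ρT a) (g : M →ₗ[k] N) :
    d₀ ρU ρS (g ∘ₗ a) = pre a (d₀ ρT ρS g) := by
  have ha' : ρT.coact ∘ₗ a = a.rTensor C ∘ₗ ρU.coact := ha
  simp only [d₀, pre, LinearMap.coe_mk, AddHom.coe_mk, LinearMap.lcomp_apply',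
    LinearMap.sub_comp, LinearMap.rTensor_comp, LinearMap.comp_assoc, ha']

theorem d₁_pre {ρT : RightComodule k C M} {ρU : RightComodule k C P} (ρS : RightComodule k C N)
    {a : P →ₗ[k] M} (ha : IsHom ρU ρT a) (f : M →ₗ[k] N ⊗[k] C) :
    d₁ ρU ρS (pre a f) = d₁ ρT ρS f ∘ₗ a := by
  have ha' : ρT.coact ∘ₗ a = a.rTensor C ∘ₗ ρU.coact := ha
  simp only [d₁, pre, LinearMap.coe_mk, AddHom.coe_mk, LinearMap.lcomp_apply',
    LinearMap.sub_comp, LinearMap.add_comp, LinearMap.rTensor_comp, LinearMap.comp_assoc, ha']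

/-- `Ext¹_C(T, S)`, as the first cohomology of the complex
`Hom_k(T, S) → Hom_k(T, S ⊗ C) → Hom_k(T, S ⊗ C ⊗ C)`, which is `Hom_C(T, -)` applied to the
standard injective (cofree) resolution `S ⊗ C → S ⊗ C ⊗ C → ⋯` of `S`. A cocycle `f` is the same as
an extension `0 → S → S ⊕ T → T → 0` with coaction `(s, t) ↦ ρ_S s + ρ_T t + f t`; it is a
coboundary if and only if this extension splits. -/
def Ext1 (ρT : RightComodule k C M) (ρS : RightComodule k C N) : Type v :=
  MiddleCohomology (d₀ ρT ρS) (d₁ ρT ρS)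

noncomputable instance (ρT : RightComodule k C M) (ρS : RightComodule k C N) :
    AddCommGroup (Ext1 ρT ρS) :=
  inferInstanceAs (AddCommGroup (MiddleCohomology (d₀ ρT ρS) (d₁ ρT ρS)))

noncomputable instance (ρT : RightComodule k C M) (ρS : RightComodule k C N) :
    Module k (Ext1 ρT ρS) :=
  inferInstanceAs (Module k (MiddleCohomology (d₀ ρT ρS) (d₁ ρT ρS)))

/-- The class in `Ext¹` of a cocycle. -/
noncomputable def Ext1.mk (ρT : RightComodule k C M) (ρS : RightComodule k C N) :
    LinearMap.ker (d₁ ρT ρS) →ₗ[k] Ext1 ρT ρS :=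
  MiddleCohomology.mk (d₀ ρT ρS) (d₁ ρT ρS)

/-- A linear map on cochains which preserves cocycles and coboundaries induces one on `Ext¹`. -/
noncomputable def Ext1.induced (ρT : RightComodule k C M) (ρS : RightComodule k C N)
    (φ : (M →ₗ[k] N ⊗[k] C) →ₗ[k] (M →ₗ[k] N ⊗[k] C))
    (hZ : ∀ f ∈ LinearMap.ker (d₁ ρT ρS), φ f ∈ LinearMap.ker (d₁ ρT ρS))
    (hB : ∀ f ∈ LinearMap.range (d₀ ρT ρS), φ f ∈ LinearMap.range (d₀ ρT ρS)) :
    Module.End k (Ext1 ρT ρS) :=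
  MiddleCohomology.induced (d₀ ρT ρS) (d₁ ρT ρS) φ hZ hB

theorem Ext1.induced_mk (ρT : RightComodule k C M) (ρS : RightComodule k C N)
    (φ : (M →ₗ[k] N ⊗[k] C) →ₗ[k] (M →ₗ[k] N ⊗[k] C)) (hZ) (hB)
    (f : LinearMap.ker (d₁ ρT ρS)) :
    Ext1.induced ρT ρS φ hZ hB (Ext1.mk ρT ρS f) = Ext1.mk ρT ρS ⟨φ f.1, hZ f.1 f.2⟩ :=
  rfl

theorem Ext1.mk_surjective (ρT : RightComodule k C M) (ρS : RightComodule k C N) :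
    Function.Surjective (Ext1.mk ρT ρS) :=
  MiddleCohomology.mk_surjective (d₀ ρT ρS) (d₁ ρT ρS)

/-- The left action of `End_C(S)` on `Ext¹_C(T, S)`, given by `b · [f] = [(b ⊗ id) f]`. -/
noncomputable def Ext1.leftAction (ρT : RightComodule k C M) (ρS : RightComodule k C N) :
    ρS.endAlgebra →+* Module.End k (Ext1 ρT ρS) where
  toFun b := Ext1.induced ρT ρS (post C b.1)
    (fun f hf => by
      have hb : IsHom ρS ρS b.1 := b.2
      rw [LinearMap.mem_ker] at hf ⊢
      rw [d₁_post ρT hb, hf, LinearMap.comp_zero])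
    (by
      rintro _ ⟨g, rfl⟩
      have hb : IsHom ρS ρS b.1 := b.2
      exact ⟨b.1 ∘ₗ g, d₀_post ρT hb g⟩)
  map_one' := by
    ext x
    obtain ⟨f, rfl⟩ := Ext1.mk_surjective ρT ρS x
    rw [Ext1.induced_mk]
    refine congrArg _ (Subtype.ext ?_)
    change (LinearMap.rTensor C (LinearMap.id : N →ₗ[k] N)) ∘ₗ f.1 = f.1
    rw [LinearMap.rTensor_id, LinearMap.id_comp]
  map_mul' a b := by
    ext x
    obtain ⟨f, rfl⟩ := Ext1.mk_surjective ρT ρS x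
    rw [Module.End.mul_apply, Ext1.induced_mk, Ext1.induced_mk, Ext1.induced_mk]
    refine congrArg _ (Subtype.ext ?_)
    change (LinearMap.rTensor C (a.1 ∘ₗ b.1)) ∘ₗ f.1 = a.1.rTensor C ∘ₗ b.1.rTensor C ∘ₗ f.1
    rw [LinearMap.rTensor_comp, LinearMap.comp_assoc]
  map_zero' := by
    ext x
    obtain ⟨f, rfl⟩ := Ext1.mk_surjective ρT ρS x
    rw [Ext1.induced_mk, LinearMap.zero_apply, ← map_zero (Ext1.mk ρT ρS)]
    refine congrArg _ (Subtype.ext ?_)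
    change (LinearMap.rTensor C (0 : N →ₗ[k] N)) ∘ₗ f.1 = 0
    rw [LinearMap.rTensor_zero, LinearMap.zero_comp]
  map_add' a b := by
    ext x
    obtain ⟨f, rfl⟩ := Ext1.mk_surjective ρT ρS x
    rw [LinearMap.add_apply, Ext1.induced_mk, Ext1.induced_mk, Ext1.induced_mk, ← map_add]
    refine congrArg _ (Subtype.ext ?_)
    change (LinearMap.rTensor C (a.1 + b.1)) ∘ₗ f.1 = a.1.rTensor C ∘ₗ f.1 + b.1.rTensor C ∘ₗ f.1
    rw [LinearMap.rTensor_add, LinearMap.add_comp]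

/-- The right action of `End_C(T)` on `Ext¹_C(T, S)`, given by `[f] · a = [f a]`. -/
noncomputable def Ext1.rightAction (ρT : RightComodule k C M) (ρS : RightComodule k C N) :
    (ρT.endAlgebra)ᵐᵒᵖ →+* Module.End k (Ext1 ρT ρS) where
  toFun a := Ext1.induced ρT ρS (pre a.unop.1)
    (fun f hf => by
      have ha : IsHom ρT ρT a.unop.1 := a.unop.2
      rw [LinearMap.mem_ker] at hf ⊢
      rw [d₁_pre ρS ha, hf, LinearMap.zero_comp])
    (by
      rintro _ ⟨g, rfl⟩
      have ha : IsHom ρT ρT a.unop.1 := a.unop.2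
      exact ⟨g ∘ₗ a.unop.1, d₀_pre ρS ha g⟩)
  map_one' := by
    ext x
    obtain ⟨f, rfl⟩ := Ext1.mk_surjective ρT ρS x
    rfl
  map_mul' a b := by
    ext x
    obtain ⟨f, rfl⟩ := Ext1.mk_surjective ρT ρS x
    rfl
  map_zero' := by
    ext x
    obtain ⟨f, rfl⟩ := Ext1.mk_surjective ρT ρS x
    rw [Ext1.induced_mk, LinearMap.zero_apply, ← map_zero (Ext1.mk ρT ρS)]
    refine congrArg _ (Subtype.ext ?_)
    change f.1 ∘ₗ (0 : M →ₗ[k] M) = 0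
    rw [LinearMap.comp_zero]
  map_add' a b := by
    ext x
    obtain ⟨f, rfl⟩ := Ext1.mk_surjective ρT ρS x
    rw [LinearMap.add_apply, Ext1.induced_mk, Ext1.induced_mk, Ext1.induced_mk, ← map_add]
    refine congrArg _ (Subtype.ext ?_)
    change f.1 ∘ₗ (a.unop.1 + b.unop.1) = f.1 ∘ₗ a.unop.1 + f.1 ∘ₗ b.unop.1
    rw [LinearMap.comp_add]

/-- `Ext¹_C(T, S)` as a left `End_C(S)`-module. -/
noncomputable instance (ρT : RightComodule k C M) (ρS : RightComodule k C N) :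
    Module ρS.endAlgebra (Ext1 ρT ρS) :=
  Module.compHom _ (Ext1.leftAction ρT ρS)

/-- `Ext¹_C(T, S)` as a right `End_C(T)`-module. -/
noncomputable instance (ρT : RightComodule k C M) (ρS : RightComodule k C N) :
    Module (ρT.endAlgebra)ᵐᵒᵖ (Ext1 ρT ρS) :=
  Module.compHom _ (Ext1.rightAction ρT ρS)

end General

/-- `C` as a right comodule over itself. -/
noncomputable def regular (k : Type u) (C : Type v) [Field k] [AddCommGroup C] [Module k C]
    [Coalgebra k C] : RightComodule k C C where
  coact := Coalgebra.comul
  coassoc := Coalgebra.coassoc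
  counit_coact := Coalgebra.lTensor_counit_comp_comul

end RightComodule

/-- A valued quiver whose vertices are taken from `V`; `arrow x y c d` says that there is an arrow
`x → y` with value `(c, d)`. -/
structure ValuedQuiver (V : Type v) where
  vertices : Set V
  arrow : V → V → Cardinal.{v} → Cardinal.{v} → Prop

/-- The valued quiver `Q` with its vertices renamed by `φ`. -/
def ValuedQuiver.map {V W : Type v} (φ : V → W) (Q : ValuedQuiver V) : ValuedQuiver W where
  vertices := φ '' Q.vertices
  arrow x y c d := ∃ x' y', φ x' = x ∧ φ y' = y ∧ Q.arrow x' y' c d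

section Coalgebras

variable (k : Type u) (C : Type v) [Field k] [AddCommGroup C] [Module k C] [Coalgebra k C]

/-- `S` is a simple right subcomodule of `C`. -/
def IsSimpleSubcomodule (S : Submodule k C) : Prop :=
  ∃ h : (RightComodule.regular k C).IsSubcomodule S,
    ((RightComodule.regular k C).restrict S h).IsSimple

/-- `C` is basic: the socle of the right comodule `C` is multiplicity free, that is, distinct simple
right subcomodules of `C` are not isomorphic. As every simple right comodule embeds in `C`, the
simple right subcomodules of a basic `C` form a complete set of pairwise non-isomorphic simple right
`C`-comodules. -/
def IsBasicCoalgebra : Prop :=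
  ∀ (S T : Submodule k C) (hS : (RightComodule.regular k C).IsSubcomodule S)
    (hT : (RightComodule.regular k C).IsSubcomodule T),
    ((RightComodule.regular k C).restrict S hS).IsSimple →
    ((RightComodule.regular k C).restrict T hT).IsSimple →
    ((RightComodule.regular k C).restrict S hS).Iso ((RightComodule.regular k C).restrict T hT) →
    S = T

/-- The right valued Gabriel quiver of a basic coalgebra `C`. The vertices are the simple right
comodules, realised in `C`; there is an arrow `T → S` if and only if `Ext¹_C(T, S) ≠ 0`, and its
value is `(d', d'')` where `d'` is the dimension of `Ext¹_C(T, S)` as a right `End_C(T)`-module and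
`d''` its dimension as a left `End_C(S)`-module. -/
noncomputable def gabrielQuiver : ValuedQuiver (Submodule k C) where
  vertices := {S | IsSimpleSubcomodule k C S}
  arrow T S c d :=
    ∃ (hT : (RightComodule.regular k C).IsSubcomodule T)
      (hS : (RightComodule.regular k C).IsSubcomodule S),
      ((RightComodule.regular k C).restrict T hT).IsSimple ∧
      ((RightComodule.regular k C).restrict S hS).IsSimple ∧
      Nontrivial (RightComodule.Ext1 ((RightComodule.regular k C).restrict T hT)
        ((RightComodule.regular k C).restrict S hS)) ∧
      c = Module.rank ((RightComodule.regular k C).restrict T hT).endAlgebraᵐᵒᵖ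
        (RightComodule.Ext1 ((RightComodule.regular k C).restrict T hT)
          ((RightComodule.regular k C).restrict S hS)) ∧
      d = Module.rank ((RightComodule.regular k C).restrict S hS).endAlgebra
        (RightComodule.Ext1 ((RightComodule.regular k C).restrict T hT)
          ((RightComodule.regular k C).restrict S hS))

/-- Subcoalgebras: subspaces `E ⊆ C` with `Δ(E) ⊆ E ⊗ E`. -/
structure Subcoalgebra where
  carrier : Submodule k C
  comul_mem' : ∀ x ∈ carrier, Coalgebra.comul (R := k) x ∈
    LinearMap.range (TensorProduct.map carrier.subtype carrier.subtype)

end Coalgebras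

namespace Subcoalgebra

variable {k : Type u} {C : Type v} [Field k] [AddCommGroup C] [Module k C] [Coalgebra k C]

theorem map_subtype_injective {V W : Type*} [AddCommGroup V] [Module k V] [AddCommGroup W]
    [Module k W] (E : Submodule k V) (F : Submodule k W) :
    Function.Injective (TensorProduct.map E.subtype F.subtype) :=
  TensorProduct.map_injective_of_flat_flat _ _ E.injective_subtype F.injective_subtype

/-- The comultiplication `E → E ⊗ E` of a subcoalgebra. -/
noncomputable def subComul (E : Subcoalgebra k C) :
    E.carrier →ₗ[k] E.carrier ⊗[k] E.carrier :=
  (LinearEquiv.ofInjective _ (map_subtype_injective E.carrier E.carrier)).symm.toLinearMap ∘ₗ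
    (Coalgebra.comul ∘ₗ E.carrier.subtype).codRestrict _ (fun x => E.comul_mem' x x.2)

theorem map_comp_subComul (E : Subcoalgebra k C) :
    TensorProduct.map E.carrier.subtype E.carrier.subtype ∘ₗ E.subComul =
      Coalgebra.comul ∘ₗ E.carrier.subtype := by
  ext x
  have := LinearEquiv.apply_symm_apply
    (LinearEquiv.ofInjective _ (map_subtype_injective E.carrier E.carrier))
    ⟨Coalgebra.comul (R := k) x.1, E.comul_mem' x x.2⟩
  exact congrArg Subtype.val this

/-- A subcoalgebra is a coalgebra, with the restricted comultiplication and counit. -/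
noncomputable instance (E : Subcoalgebra k C) : Coalgebra k E.carrier where
  comul := E.subComul
  counit := Coalgebra.counit ∘ₗ E.carrier.subtype
  coassoc := by
    have key := E.map_comp_subComul
    let i := E.carrier.subtype
    let j := TensorProduct.map i i
    have inj : Function.Injective (TensorProduct.map i j) :=
      TensorProduct.map_injective_of_flat_flat _ _ E.carrier.injective_subtype
        (map_subtype_injective E.carrier E.carrier)
    have nat0 : TensorProduct.map i j ∘ₗ
        (TensorProduct.assoc k E.carrier E.carrier E.carrier).toLinearMap =
        (TensorProduct.assoc k C C C).toLinearMap ∘ₗ TensorProduct.map j i := by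
      ext; rfl
    have h1 : TensorProduct.map j i ∘ₗ E.subComul.rTensor E.carrier =
        (Coalgebra.comul (R := k) (A := C)).rTensor C ∘ₗ j := by
      rw [LinearMap.map_comp_rTensor, LinearMap.rTensor_comp_map]
      exact congrArg (fun f => TensorProduct.map f i) key
    have h2 : TensorProduct.map i j ∘ₗ E.subComul.lTensor E.carrier =
        (Coalgebra.comul (R := k) (A := C)).lTensor C ∘ₗ j := by
      rw [LinearMap.map_comp_lTensor, LinearMap.lTensor_comp_map]
      exact congrArg (fun f => TensorProduct.map i f) key
    have key' : j ∘ₗ E.subComul = Coalgebra.comul ∘ₗ i := key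
    have e : TensorProduct.map i j ∘ₗ ((TensorProduct.assoc k E.carrier E.carrier
        E.carrier).toLinearMap ∘ₗ E.subComul.rTensor E.carrier ∘ₗ E.subComul) =
        TensorProduct.map i j ∘ₗ (E.subComul.lTensor E.carrier ∘ₗ E.subComul) := by
      rw [← LinearMap.comp_assoc, nat0, LinearMap.comp_assoc,
        ← LinearMap.comp_assoc _ _ (TensorProduct.map j i), h1, LinearMap.comp_assoc, key',
        ← LinearMap.comp_assoc _ _ (TensorProduct.map i j), h2, LinearMap.comp_assoc, key']
      exact congrArg (fun f => f ∘ₗ i) (Coalgebra.coassoc (R := k) (A := C))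
    exact LinearMap.ext fun x => inj (LinearMap.congr_fun e x)
  rTensor_counit_comp_comul := by
    have key := E.map_comp_subComul
    let i := E.carrier.subtype
    have inj : Function.Injective (i.lTensor k) :=
      Module.Flat.lTensor_preserves_injective_linearMap _ E.carrier.injective_subtype
    have nat : i.lTensor k ∘ₗ (Coalgebra.counit (R := k) (A := C) ∘ₗ i).rTensor E.carrier =
        (Coalgebra.counit (R := k) (A := C)).rTensor C ∘ₗ TensorProduct.map i i := by
      ext; rfl
    have e : i.lTensor k ∘ₗ ((Coalgebra.counit (R := k) (A := C) ∘ₗ i).rTensor E.carrier ∘ₗ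
        E.subComul) = i.lTensor k ∘ₗ TensorProduct.mk k k E.carrier 1 := by
      rw [← LinearMap.comp_assoc, nat, LinearMap.comp_assoc, key, ← LinearMap.comp_assoc,
        Coalgebra.rTensor_counit_comp_comul]
      rfl
    exact LinearMap.ext fun x => inj (LinearMap.congr_fun e x)
  lTensor_counit_comp_comul := by
    have key := E.map_comp_subComul
    let i := E.carrier.subtype
    have inj : Function.Injective (i.rTensor k) :=
      Module.Flat.rTensor_preserves_injective_linearMap _ E.carrier.injective_subtype
    have nat : i.rTensor k ∘ₗ (Coalgebra.counit (R := k) (A := C) ∘ₗ i).lTensor E.carrier =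
        (Coalgebra.counit (R := k) (A := C)).lTensor C ∘ₗ TensorProduct.map i i := by
      ext; rfl
    have e : i.rTensor k ∘ₗ ((Coalgebra.counit (R := k) (A := C) ∘ₗ i).lTensor E.carrier ∘ₗ
        E.subComul) = i.rTensor k ∘ₗ (TensorProduct.mk k E.carrier k).flip 1 := by
      rw [← LinearMap.comp_assoc, nat, LinearMap.comp_assoc, key, ← LinearMap.comp_assoc,
        Coalgebra.lTensor_counit_comp_comul]
      rfl
    exact LinearMap.ext fun x => inj (LinearMap.congr_fun e x)

/-- The wedge `A ∧ B`, the kernel of `C → C ⊗ C → C/A ⊗ C/B`. -/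
noncomputable def wedgeSubmodule (A B : Submodule k C) : Submodule k C :=
  LinearMap.ker (TensorProduct.map A.mkQ B.mkQ ∘ₗ Coalgebra.comul)

/-- An element of `V ⊗ V` killed by both `V ⊗ V → V/W ⊗ V` and `V ⊗ V → V ⊗ V/W` lies in
`W ⊗ W`. -/
theorem mem_range_map_of_mkQ {V : Type*} [AddCommGroup V] [Module k V] (W : Submodule k V)
    (x : V ⊗[k] V) (h1 : W.mkQ.rTensor V x = 0) (h2 : W.mkQ.lTensor V x = 0) :
    x ∈ LinearMap.range (TensorProduct.map W.subtype W.subtype) := by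
  have ex : Function.Exact W.subtype W.mkQ := LinearMap.exact_subtype_mkQ W
  obtain ⟨y, rfl⟩ := (rTensor_exact V ex W.mkQ_surjective x).1 h1
  have h3 : W.subtype.rTensor (V ⧸ W) (W.mkQ.lTensor W y) = 0 := by
    rw [← h2]
    exact LinearMap.congr_fun ((LinearMap.rTensor_comp_lTensor ..).trans
      (LinearMap.lTensor_comp_rTensor ..).symm) y
  have h4 : W.mkQ.lTensor W y = 0 :=
    Module.Flat.rTensor_preserves_injective_linearMap (M := V ⧸ W) _ W.injective_subtype
      (h3.trans (map_zero _).symm)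
  obtain ⟨z, rfl⟩ := (lTensor_exact W ex W.mkQ_surjective y).1 h4
  exact ⟨z, (LinearMap.congr_fun (LinearMap.rTensor_comp_lTensor ..) z).symm⟩

/-- `Δ(E) ⊆ C ⊗ E` for a subcoalgebra `E`, in the form: `Δ` descends to `C/E → C ⊗ C/E`. -/
theorem lTensor_mkQ_comul (E : Subcoalgebra k C) {x : C} (hx : x ∈ E.carrier) :
    E.carrier.mkQ.lTensor C (Coalgebra.comul (R := k) x) = 0 := by
  obtain ⟨y, hy⟩ := E.comul_mem' x hx
  rw [← hy]
  have : E.carrier.mkQ.lTensor C ∘ₗ TensorProduct.map E.carrier.subtype E.carrier.subtype = 0 := by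
    rw [LinearMap.lTensor_comp_map, show E.carrier.mkQ ∘ₗ E.carrier.subtype = 0 by ext; simp, TensorProduct.map_zero_right]
  exact LinearMap.congr_fun this y

/-- `Δ(E) ⊆ E ⊗ C` for a subcoalgebra `E`, in the form: `Δ` descends to `C/E → C/E ⊗ C`. -/
theorem rTensor_mkQ_comul (E : Subcoalgebra k C) {x : C} (hx : x ∈ E.carrier) :
    E.carrier.mkQ.rTensor C (Coalgebra.comul (R := k) x) = 0 := by
  obtain ⟨y, hy⟩ := E.comul_mem' x hx
  rw [← hy]
  have : E.carrier.mkQ.rTensor C ∘ₗ TensorProduct.map E.carrier.subtype E.carrier.subtype = 0 := by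
    rw [LinearMap.rTensor_comp_map, show E.carrier.mkQ ∘ₗ E.carrier.subtype = 0 by ext; simp, TensorProduct.map_zero_left]
  exact LinearMap.congr_fun this y

/-- If `K` is the kernel of `g`, then `K ⊗ V` is the kernel of `g ⊗ V`. -/
theorem rTensor_mkQ_eq_zero {V W U : Type*} [AddCommGroup V] [Module k V] [AddCommGroup W]
    [Module k W] [AddCommGroup U] [Module k U] (g : W →ₗ[k] U) (x : W ⊗[k] V)
    (h : g.rTensor V x = 0) : (LinearMap.ker g).mkQ.rTensor V x = 0 := by
  obtain ⟨y, rfl⟩ := (Module.Flat.rTensor_exact V (LinearMap.exact_subtype_ker_map g) x).1 h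
  exact (rTensor_exact V (LinearMap.exact_subtype_mkQ _) (Submodule.mkQ_surjective _) _).2 ⟨y, rfl⟩

theorem lTensor_mkQ_eq_zero {V W U : Type*} [AddCommGroup V] [Module k V] [AddCommGroup W]
    [Module k W] [AddCommGroup U] [Module k U] (g : W →ₗ[k] U) (x : V ⊗[k] W)
    (h : g.lTensor V x = 0) : (LinearMap.ker g).mkQ.lTensor V x = 0 := by
  obtain ⟨y, rfl⟩ := (Module.Flat.lTensor_exact V (LinearMap.exact_subtype_ker_map g) x).1 h
  exact (lTensor_exact V (LinearMap.exact_subtype_mkQ _) (Submodule.mkQ_surjective _) _).2 ⟨y, rfl⟩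

/-- The wedge product `A ∧ B` of two subcoalgebras is a subcoalgebra. -/
noncomputable def wedge (A B : Subcoalgebra k C) : Subcoalgebra k C where
  carrier := wedgeSubmodule A.carrier B.carrier
  comul_mem' := by
    intro x hx
    have hx' : TensorProduct.map A.carrier.mkQ B.carrier.mkQ (Coalgebra.comul (R := k) x) = 0 := hx
    let p := A.carrier.mkQ
    let q := B.carrier.mkQ
    refine mem_range_map_of_mkQ _ _ (rTensor_mkQ_eq_zero _ _ ?_) (lTensor_mkQ_eq_zero _ _ ?_)
    · let D : C ⧸ B.carrier →ₗ[k] (C ⧸ B.carrier) ⊗[k] C :=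
        B.carrier.liftQ (q.rTensor C ∘ₗ Coalgebra.comul) (fun y hy => B.rTensor_mkQ_comul hy)
      have hD : D ∘ₗ q = q.rTensor C ∘ₗ Coalgebra.comul := Submodule.liftQ_mkQ _ _ _
      apply (TensorProduct.assoc k (C ⧸ A.carrier) (C ⧸ B.carrier) C).injective
      rw [map_zero]
      have nat : (TensorProduct.assoc k (C ⧸ A.carrier) (C ⧸ B.carrier) C).toLinearMap ∘ₗ
          (TensorProduct.map p q).rTensor C = TensorProduct.map p (q.rTensor C) ∘ₗ
          (TensorProduct.assoc k C C C).toLinearMap := by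
        ext; rfl
      have nat2 : TensorProduct.map p (q.rTensor C) ∘ₗ
          (Coalgebra.comul (R := k) (A := C)).lTensor C =
          D.lTensor (C ⧸ A.carrier) ∘ₗ TensorProduct.map p q := by
        rw [LinearMap.map_comp_lTensor, LinearMap.lTensor_comp_map, hD]
      have h1 := LinearMap.congr_fun nat ((Coalgebra.comul (R := k) (A := C)).rTensor C
        (Coalgebra.comul x))
      have h2 := LinearMap.congr_fun nat2 (Coalgebra.comul x)
      simp only [LinearMap.comp_apply, LinearEquiv.coe_coe, Coalgebra.coassoc_apply] at h1 h2
      rw [LinearMap.rTensor_comp, LinearMap.comp_apply, h1, h2]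
      exact (congrArg _ hx').trans (map_zero _)
    · let D : C ⧸ A.carrier →ₗ[k] C ⊗[k] (C ⧸ A.carrier) :=
        A.carrier.liftQ (p.lTensor C ∘ₗ Coalgebra.comul) (fun y hy => A.lTensor_mkQ_comul hy)
      have hD : D ∘ₗ p = p.lTensor C ∘ₗ Coalgebra.comul := Submodule.liftQ_mkQ _ _ _
      apply (TensorProduct.assoc k C (C ⧸ A.carrier) (C ⧸ B.carrier)).symm.injective
      rw [map_zero]
      have nat : (TensorProduct.assoc k C (C ⧸ A.carrier) (C ⧸ B.carrier)).symm.toLinearMap ∘ₗ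
          (TensorProduct.map p q).lTensor C = TensorProduct.map (p.lTensor C) q ∘ₗ
          (TensorProduct.assoc k C C C).symm.toLinearMap := by
        apply TensorProduct.ext_threefold'
        intros; rfl
      have nat2 : TensorProduct.map (p.lTensor C) q ∘ₗ
          (Coalgebra.comul (R := k) (A := C)).rTensor C =
          D.rTensor (C ⧸ B.carrier) ∘ₗ TensorProduct.map p q := by
        rw [LinearMap.map_comp_rTensor, LinearMap.rTensor_comp_map, hD]
      have h1 := LinearMap.congr_fun nat ((Coalgebra.comul (R := k) (A := C)).lTensor C
        (Coalgebra.comul x))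
      have h2 := LinearMap.congr_fun nat2 (Coalgebra.comul x)
      simp only [LinearMap.comp_apply, LinearEquiv.coe_coe, Coalgebra.coassoc_symm_apply] at h1 h2
      rw [LinearMap.lTensor_comp, LinearMap.comp_apply, h1, h2]
      exact (congrArg _ hx').trans (map_zero _)

/-- The right valued Gabriel quiver of a subcoalgebra `E` of `C`, with each simple right
`E`-comodule `S ⊆ E` regarded as a subspace of `C`. -/
noncomputable def quiver (E : Subcoalgebra k C) : ValuedQuiver (Submodule k C) :=
  (gabrielQuiver k E.carrier).map (Submodule.map E.carrier.subtype)

end Subcoalgebra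

/-! Write `p : C → C/A` and `q : C → C/B` for the projections.

Comparison of quivers. An injective coalgebra map `D → C` induces a map `Ext¹_D(T, S) → Ext¹_C(T,
S)`. It is always injective, because a linear splitting that is colinear over `C` is already
colinear over `D`. It is semilinear along `End_D ≃ End_C`, so dimensions can only grow from `D` to
`C`. It is bijective once every cocycle over `C` is cohomologous to one with values in `S ⊗ D`
(`arrow_map_iff`). Each comparison of arrows thus becomes a question about where cocycles take their
values.

Cocycles. The cocycle identity is `(id ⊗ Δ) f = (ρ_S ⊗ id) f + (f ⊗ id) ρ_T`. Apply `id ⊗ p ⊗ q`. If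
`S` is an `A`-comodule and `T` a `B`-comodule, both terms on the right vanish, so `f` has values in
`S ⊗ (A ∧ B)`; this is case (ii). In the other cases replace `C` by `A ∧ B`, where `(p ⊗ q) Δ = 0`.
If `S` is an `A`-comodule and the simple `T` is not a `B`-comodule, the elements `t` with `f t ∈ S ⊗
A` form a subcomodule of `T`. It is nonzero, since otherwise `T` would be a `B`-comodule, so it is
all of `T`; this is case (iii).

If `S` is not an `A`-comodule, consider the extension `E = S ⊕ T` defined by `f` and the part `E_A`
with coefficients in `A`. It meets `S` in zero, so it embeds in `T`. If its image is `T`, then `E_A`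
splits the extension. If its image is `0`, then `E = E/E_A` is a `B`-comodule, hence so is `T`, and
`f` has values in `S ⊗ B` (`coboundary_or_lTensor_mkQ_eq_zero`). This gives (i) and (iv). The same
dichotomy for a simple comodule (`S_A = S` or `S_A = 0`) gives the vertices. -/

namespace RightComodule

/-! ### Change of coalgebra along an injective map `D → C` -/

section Transfer

variable {k : Type u} {C D M N P Q : Type v} [Field k] [AddCommGroup C] [Module k C]
  [AddCommGroup D] [Module k D]
  [AddCommGroup M] [Module k M] [AddCommGroup N] [Module k N] [AddCommGroup P] [Module k P]
  [AddCommGroup Q] [Module k Q]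

/-- Right exactness of the tensor product. It turns conditions on coactions into equations that can
be composed with linear maps. -/
theorem mem_range_rTensor_subtype_iff (C : Type*) [AddCommGroup C] [Module k C]
    (W : Submodule k M) (x : M ⊗[k] C) :
    x ∈ LinearMap.range (W.subtype.rTensor C) ↔ W.mkQ.rTensor C x = 0 :=
  ((rTensor_exact C (LinearMap.exact_subtype_mkQ W) W.mkQ_surjective) x).symm

theorem mem_range_lTensor_subtype_iff (M : Type*) [AddCommGroup M] [Module k M]
    (W : Submodule k C) (x : M ⊗[k] C) :
    x ∈ LinearMap.range (W.subtype.lTensor M) ↔ W.mkQ.lTensor M x = 0 :=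
  ((lTensor_exact M (LinearMap.exact_subtype_mkQ W) W.mkQ_surjective) x).symm

section Cochains

variable (φ : D →ₗ[k] C) (ψT : M ≃ₗ[k] P) (ψS : N ≃ₗ[k] Q)

/-- The map of cochains `Hom(T', S' ⊗ D) → Hom(T, S ⊗ C)` induced by `T' ≃ T`, `S' ≃ S`
and `D → C`. -/
noncomputable def cochainMap : (M →ₗ[k] N ⊗[k] D) →ₗ[k] (P →ₗ[k] Q ⊗[k] C) where
  toFun f := TensorProduct.map ψS.toLinearMap φ ∘ₗ f ∘ₗ ψT.symm.toLinearMap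
  map_add' f g := by rw [LinearMap.add_comp, LinearMap.comp_add]
  map_smul' r f := by rw [LinearMap.smul_comp, LinearMap.comp_smul, RingHom.id_apply]

variable {φ ψT ψS}

theorem cochainMap_apply (f : M →ₗ[k] N ⊗[k] D) (t : M) :
    cochainMap φ ψT ψS f (ψT t) = TensorProduct.map ψS.toLinearMap φ (f t) := by
  simp [cochainMap]

theorem cochainMap_injective (hφ : Function.Injective φ) :
    Function.Injective (cochainMap φ ψT ψS) := by
  intro f g h
  ext t
  apply TensorProduct.map_injective_of_flat_flat ψS.toLinearMap φ ψS.injective hφ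
  rw [← cochainMap_apply (ψT := ψT), h, cochainMap_apply]

end Cochains

variable [Coalgebra k C] [Coalgebra k D]

/-- `ψ : M → N` is a morphism from a `D`-comodule to a `C`-comodule along `φ : D → C`. -/
def IsHomOver (φ : D →ₗ[k] C) (ρM : RightComodule k D M) (ρN : RightComodule k C N)
    (ψ : M →ₗ[k] N) : Prop :=
  ρN.coact ∘ₗ ψ = TensorProduct.map ψ φ ∘ₗ ρM.coact

/-- The induced map `M/W → N/ψ(W)` is injective, and over a field so is its tensor product with `φ`;
hence the obstruction to being a subcomodule vanishes on one side exactly when it does on the other.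
-/
theorem IsHomOver.isSubcomodule_map_iff {φ : D →ₗ[k] C} {ρM : RightComodule k D M}
    {ρN : RightComodule k C N} {ψ : M →ₗ[k] N} (h : IsHomOver φ ρM ρN ψ)
    (hφ : Function.Injective φ) (hψ : Function.Injective ψ) (W : Submodule k M) :
    ρN.IsSubcomodule (W.map ψ) ↔ ρM.IsSubcomodule W := by
  let ψ' : M ⧸ W →ₗ[k] N ⧸ W.map ψ := W.mapQ (W.map ψ) ψ (W.le_comap_map ψ)
  have hψ' : Function.Injective ψ' := by
    rw [← LinearMap.ker_eq_bot, Submodule.ker_mapQ, Submodule.comap_map_eq_of_injective hψ,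
      Submodule.mkQ_map_self]
  have e : (W.map ψ).mkQ.rTensor C ∘ₗ TensorProduct.map ψ φ =
      TensorProduct.map ψ' φ ∘ₗ W.mkQ.rTensor D := by
    ext; rfl
  have key (w : M) : (W.map ψ).mkQ.rTensor C (ρN.coact (ψ w)) = 0 ↔
      W.mkQ.rTensor D (ρM.coact w) = 0 := by
    rw [show ρN.coact (ψ w) = TensorProduct.map ψ φ (ρM.coact w) from LinearMap.congr_fun h w,
      show (W.map ψ).mkQ.rTensor C (TensorProduct.map ψ φ (ρM.coact w)) = _ from
        LinearMap.congr_fun e (ρM.coact w)]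
    exact map_eq_zero_iff _ (TensorProduct.map_injective_of_flat_flat _ _ hψ' hφ)
  simp only [IsSubcomodule, mem_range_rTensor_subtype_iff]
  constructor
  · exact fun H w hw => (key w).1 (H _ (Submodule.mem_map_of_mem hw))
  · rintro H _ ⟨w, hw, rfl⟩
    exact (key w).2 (H w hw)

theorem IsHomOver.isSimple_iff {φ : D →ₗ[k] C} {ρM : RightComodule k D M}
    {ρN : RightComodule k C N} {ψ : M ≃ₗ[k] N} (h : IsHomOver φ ρM ρN ψ.toLinearMap)
    (hφ : Function.Injective φ) : ρN.IsSimple ↔ ρM.IsSimple := by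
  have key := h.isSubcomodule_map_iff hφ ψ.injective
  refine and_congr ψ.toEquiv.nontrivial_congr.symm ⟨fun H W hW => ?_, fun H W hW => ?_⟩
  · have := H _ ((key W).2 hW)
    simpa using this
  · have e : (W.comap ψ.toLinearMap).map ψ.toLinearMap = W :=
      Submodule.map_comap_eq_of_surjective ψ.surjective W
    rw [← e] at hW ⊢
    simpa using H _ ((key _).1 hW)

/-- After embedding `φ(S) ⊗ C` into `C ⊗ C`, this is the compatibility of `φ` with the
comultiplications. -/
theorem restrict_isHomOver (φ : D →ₗc[k] C) (hφ : Function.Injective φ.toLinearMap)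
    (S : Submodule k D)
    (h : (regular k D).IsSubcomodule S)
    (h' : (regular k C).IsSubcomodule (S.map φ.toLinearMap)) :
    IsHomOver φ.toLinearMap ((regular k D).restrict S h)
      ((regular k C).restrict (S.map φ.toLinearMap) h')
      (Submodule.equivMapOfInjective φ.toLinearMap hφ S).toLinearMap := by
  refine LinearMap.ext fun s => rTensor_subtype_injective C (S.map φ.toLinearMap) ?_
  let ψ := (Submodule.equivMapOfInjective φ.toLinearMap hφ S).toLinearMap
  have e : (S.map φ.toLinearMap).subtype.rTensor C ∘ₗ TensorProduct.map ψ φ.toLinearMap =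
      TensorProduct.map φ.toLinearMap φ.toLinearMap ∘ₗ S.subtype.rTensor D := by
    ext; rfl
  exact (LinearMap.congr_fun (subtype_comp_subCoact _ _ h') (ψ s)).trans
    ((LinearMap.congr_fun φ.map_comp_comul s.1).symm.trans
      ((congrArg (TensorProduct.map φ.toLinearMap φ.toLinearMap)
        (LinearMap.congr_fun (subtype_comp_subCoact _ _ h) s).symm).trans
        (LinearMap.congr_fun e _).symm))

theorem regular_isHomOver (φ : D →ₗc[k] C) :
    IsHomOver φ.toLinearMap (regular k D) (regular k C) φ.toLinearMap :=
  φ.map_comp_comul.symm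

theorem isSimpleSubcomodule_map_iff (φ : D →ₗc[k] C) (hφ : Function.Injective φ.toLinearMap)
    (S : Submodule k D) :
    IsSimpleSubcomodule k C (S.map φ.toLinearMap) ↔ IsSimpleSubcomodule k D S := by
  have key := (regular_isHomOver φ).isSubcomodule_map_iff hφ hφ S
  constructor
  · rintro ⟨h, hs⟩
    exact ⟨key.1 h, ((restrict_isHomOver φ hφ S (key.1 h) h).isSimple_iff hφ).1 hs⟩
  · rintro ⟨h, hs⟩
    exact ⟨key.2 h, ((restrict_isHomOver φ hφ S h (key.2 h)).isSimple_iff hφ).2 hs⟩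

/-! ### Comparison of `Ext¹` over `D` and over `C` -/

section Cochains

variable {φ : D →ₗ[k] C} {ψT : M ≃ₗ[k] P} {ψS : N ≃ₗ[k] Q}

variable {ρM : RightComodule k D M} {ρN : RightComodule k D N} {ρP : RightComodule k C P}
  {ρQ : RightComodule k C Q}

/-- With `d₁_cochainMap`, this makes `cochainMap` part of a chain map whose degree 0 component is
the conjugation `g ↦ ψS g ψT⁻¹`. -/
theorem d₀_cochainMap (hT : IsHomOver φ ρM ρP ψT.toLinearMap)
    (hS : IsHomOver φ ρN ρQ ψS.toLinearMap) (g : M →ₗ[k] N) :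
    d₀ ρP ρQ (ψS.toLinearMap ∘ₗ g ∘ₗ ψT.symm.toLinearMap) =
      cochainMap φ ψT ψS (d₀ ρM ρN g) := by
  ext t
  obtain ⟨t, rfl⟩ := ψT.surjective t
  have h1 : ρP.coact (ψT t) = TensorProduct.map ψT.toLinearMap φ (ρM.coact t) :=
    LinearMap.congr_fun hT t
  have h2 : ρQ.coact (ψS (g t)) = TensorProduct.map ψS.toLinearMap φ (ρN.coact (g t)) :=
    LinearMap.congr_fun hS (g t)
  have e : (ψS.toLinearMap ∘ₗ g ∘ₗ ψT.symm.toLinearMap).rTensor C ∘ₗ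
      TensorProduct.map ψT.toLinearMap φ =
      TensorProduct.map ψS.toLinearMap φ ∘ₗ g.rTensor D := by
    ext; simp
  have h3 := LinearMap.congr_fun e (ρM.coact t)
  rw [cochainMap_apply]
  simp only [LinearMap.comp_apply] at h3
  simp only [d₀, LinearMap.coe_mk, AddHom.coe_mk, LinearMap.sub_apply, LinearMap.comp_apply,
    map_sub, h1, h3, LinearEquiv.coe_coe, LinearEquiv.symm_apply_apply, h2]

theorem d₁_cochainMap (hφc : TensorProduct.map φ φ ∘ₗ Coalgebra.comul = Coalgebra.comul ∘ₗ φ)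
    (hT : IsHomOver φ ρM ρP ψT.toLinearMap)
    (hS : IsHomOver φ ρN ρQ ψS.toLinearMap) (f : M →ₗ[k] N ⊗[k] D) (t : M) :
    d₁ ρP ρQ (cochainMap φ ψT ψS f) (ψT t) =
      TensorProduct.map ψS.toLinearMap (TensorProduct.map φ φ) (d₁ ρM ρN f t) := by
  have h1 : ρP.coact (ψT t) = TensorProduct.map ψT.toLinearMap φ (ρM.coact t) :=
    LinearMap.congr_fun hT t
  have a : (TensorProduct.assoc k Q C C).toLinearMap ∘ₗ
      TensorProduct.map (TensorProduct.map ψS.toLinearMap φ) φ =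
      TensorProduct.map ψS.toLinearMap (TensorProduct.map φ φ) ∘ₗ
        (TensorProduct.assoc k N D D).toLinearMap := by
    ext; rfl
  have e1 : ρQ.coact.rTensor C ∘ₗ TensorProduct.map ψS.toLinearMap φ =
      TensorProduct.map (TensorProduct.map ψS.toLinearMap φ) φ ∘ₗ ρN.coact.rTensor D := by
    rw [LinearMap.rTensor_comp_map, LinearMap.map_comp_rTensor, show _ = _ from hS]
  have e2 : (Coalgebra.comul (R := k) (A := C)).lTensor Q ∘ₗ
      TensorProduct.map ψS.toLinearMap φ =
      TensorProduct.map ψS.toLinearMap (TensorProduct.map φ φ) ∘ₗ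
        (Coalgebra.comul (R := k) (A := D)).lTensor N := by
    rw [LinearMap.lTensor_comp_map, LinearMap.map_comp_lTensor, hφc]
  have e3 : (cochainMap φ ψT ψS f).rTensor C ∘ₗ TensorProduct.map ψT.toLinearMap φ =
      TensorProduct.map (TensorProduct.map ψS.toLinearMap φ) φ ∘ₗ f.rTensor D := by
    rw [LinearMap.rTensor_comp_map, LinearMap.map_comp_rTensor]
    congr 1
    ext t
    simpa using cochainMap_apply f t
  have a1 := LinearMap.congr_fun a (ρN.coact.rTensor D (f t))
  have a2 := LinearMap.congr_fun a (f.rTensor D (ρM.coact t))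
  have e1 := LinearMap.congr_fun e1 (f t)
  have e2 := LinearMap.congr_fun e2 (f t)
  have e3 := LinearMap.congr_fun e3 (ρM.coact t)
  simp only [LinearMap.comp_apply, LinearEquiv.coe_coe] at a1 a2 e1 e2 e3
  simp only [d₁, LinearMap.coe_mk, AddHom.coe_mk, LinearMap.sub_apply, LinearMap.add_apply,
    LinearMap.comp_apply, LinearEquiv.coe_coe, cochainMap_apply, h1, e1, e2, e3, a1, a2, map_sub,
    map_add]

/-- The chain map is injective in degree 2 too, so cocycles are reflected and not only preserved;
the reflection is what `ext1Map_surjective` needs. -/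
theorem d₁_cochainMap_eq_zero_iff (hφ : Function.Injective φ)
    (hφc : TensorProduct.map φ φ ∘ₗ Coalgebra.comul = Coalgebra.comul ∘ₗ φ)
    (hT : IsHomOver φ ρM ρP ψT.toLinearMap)
    (hS : IsHomOver φ ρN ρQ ψS.toLinearMap) (f : M →ₗ[k] N ⊗[k] D) :
    d₁ ρP ρQ (cochainMap φ ψT ψS f) = 0 ↔ d₁ ρM ρN f = 0 := by
  have inj : Function.Injective
      (TensorProduct.map ψS.toLinearMap (TensorProduct.map φ φ)) :=
    TensorProduct.map_injective_of_flat_flat _ _ ψS.injective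
      (TensorProduct.map_injective_of_flat_flat _ _ hφ hφ)
  constructor
  · intro h
    ext t
    apply inj
    rw [← d₁_cochainMap hφc hT hS, h]
    simp
  · intro h
    ext t
    obtain ⟨t, rfl⟩ := ψT.surjective t
    rw [d₁_cochainMap hφc hT hS, h]
    simp

/-- The map `Ext¹_D(T', S') → Ext¹_C(T, S)` induced by `T' ≃ T`, `S' ≃ S` over `D → C`. -/
noncomputable def ext1Map (hφ : Function.Injective φ)
    (hφc : TensorProduct.map φ φ ∘ₗ Coalgebra.comul = Coalgebra.comul ∘ₗ φ)
    (hT : IsHomOver φ ρM ρP ψT.toLinearMap) (hS : IsHomOver φ ρN ρQ ψS.toLinearMap) :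
    Ext1 ρM ρN →ₗ[k] Ext1 ρP ρQ :=
  Submodule.mapQ _ _ ((cochainMap φ ψT ψS).restrict (p := LinearMap.ker (d₁ ρM ρN))
    (q := LinearMap.ker (d₁ ρP ρQ))
    (fun f hf => (d₁_cochainMap_eq_zero_iff hφ hφc hT hS f).2 hf))
    (by
      rintro f ⟨g, hg⟩
      exact ⟨_, (d₀_cochainMap hT hS g).trans (congrArg _ hg)⟩)

theorem ext1Map_mk (hφ : Function.Injective φ)
    (hφc : TensorProduct.map φ φ ∘ₗ Coalgebra.comul = Coalgebra.comul ∘ₗ φ)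
    (hT : IsHomOver φ ρM ρP ψT.toLinearMap) (hS : IsHomOver φ ρN ρQ ψS.toLinearMap)
    (f : LinearMap.ker (d₁ ρM ρN)) :
    ext1Map hφ hφc hT hS (Ext1.mk ρM ρN f) =
      Ext1.mk ρP ρQ ⟨cochainMap φ ψT ψS f.1, (d₁_cochainMap_eq_zero_iff hφ hφc hT hS f.1).2 f.2⟩ :=
  rfl

theorem Ext1.mk_eq_zero_iff (f : LinearMap.ker (d₁ ρM ρN)) :
    Ext1.mk ρM ρN f = 0 ↔ ∃ g, d₀ ρM ρN g = f.1 :=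
  Submodule.Quotient.mk_eq_zero _

theorem Ext1.mk_eq_zero_of_add_d₀ (f : LinearMap.ker (d₁ ρM ρN)) {g : M →ₗ[k] N}
    (h : f.1 + d₀ ρM ρN g = 0) : Ext1.mk ρM ρN f = 0 :=
  (Ext1.mk_eq_zero_iff f).2 ⟨-g, (map_neg (d₀ ρM ρN) g).trans (neg_eq_of_add_eq_zero_left h)⟩

/-- In degree 0 the chain map is bijective, as the coalgebra plays no role there, and in degree 1 it
is injective. So a cochain that bounds over `C` bounds over `D`. -/
theorem ext1Map_injective (hφ : Function.Injective φ)
    (hφc : TensorProduct.map φ φ ∘ₗ Coalgebra.comul = Coalgebra.comul ∘ₗ φ)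
    (hT : IsHomOver φ ρM ρP ψT.toLinearMap) (hS : IsHomOver φ ρN ρQ ψS.toLinearMap) :
    Function.Injective (ext1Map hφ hφc hT hS) := by
  rw [injective_iff_map_eq_zero]
  intro x hx
  obtain ⟨f, rfl⟩ := Ext1.mk_surjective ρM ρN x
  rw [ext1Map_mk, Ext1.mk_eq_zero_iff] at hx
  obtain ⟨g, hg⟩ := hx
  rw [Ext1.mk_eq_zero_iff]
  refine ⟨ψS.symm.toLinearMap ∘ₗ g ∘ₗ ψT.toLinearMap,
    cochainMap_injective (ψT := ψT) (ψS := ψS) hφ ?_⟩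
  rw [← d₀_cochainMap hT hS]
  refine Eq.trans (congrArg _ ?_) hg
  ext; simp

/-- Here `H` says that each cocycle, corrected by a coboundary, takes values in `Q ⊗ φ(D)`. It then
lifts to a cochain over `D`, which is again a cocycle by reflection. -/
theorem ext1Map_surjective (hφ : Function.Injective φ)
    (hφc : TensorProduct.map φ φ ∘ₗ Coalgebra.comul = Coalgebra.comul ∘ₗ φ)
    (hT : IsHomOver φ ρM ρP ψT.toLinearMap) (hS : IsHomOver φ ρN ρQ ψS.toLinearMap)
    (H : ∀ f, d₁ ρP ρQ f = 0 → ∃ g, ∀ t,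
      (LinearMap.range φ).mkQ.lTensor Q ((f + d₀ ρP ρQ g) t) = 0) :
    Function.Surjective (ext1Map hφ hφc hT hS) := by
  intro x
  obtain ⟨f, rfl⟩ := Ext1.mk_surjective ρP ρQ x
  obtain ⟨g, hg⟩ := H f.1 f.2
  have inj : Function.Injective (TensorProduct.map ψS.toLinearMap φ) :=
    TensorProduct.map_injective_of_flat_flat _ _ ψS.injective hφ
  -- The retraction `l` makes the lift linear in `t`. It is a true lift because the values lie in
  -- the range of `ψS ⊗ φ`, which is `Q ⊗ φ(D)` since `ψS` is surjective.
  obtain ⟨l, hl⟩ := LinearMap.exists_leftInverse_of_injective _ (LinearMap.ker_eq_bot.2 inj)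
  let f' := l ∘ₗ (f.1 + d₀ ρP ρQ g) ∘ₗ ψT.toLinearMap
  have hf' : cochainMap φ ψT ψS f' = f.1 + d₀ ρP ρQ g := by
    ext t
    obtain ⟨t, rfl⟩ := ψT.surjective t
    rw [cochainMap_apply]
    obtain ⟨y, hy⟩ := (mem_range_lTensor_subtype_iff Q _ _).2 (hg (ψT t))
    obtain ⟨z, rfl⟩ := TensorProduct.map_surjective ψS.surjective φ.surjective_rangeRestrict y
    have e : (LinearMap.range φ).subtype.lTensor Q ∘ₗ
        TensorProduct.map ψS.toLinearMap φ.rangeRestrict =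
        TensorProduct.map ψS.toLinearMap φ := by ext; rfl
    have hz : TensorProduct.map ψS.toLinearMap φ z = (f.1 + d₀ ρP ρQ g) (ψT t) := by
      rw [← hy, ← e]; rfl
    change TensorProduct.map ψS.toLinearMap φ (l ((f.1 + d₀ ρP ρQ g) (ψT t))) = _
    rw [← hz]
    exact congrArg _ (LinearMap.congr_fun hl z)
  have hz : d₁ ρM ρN f' = 0 := by
    rw [← d₁_cochainMap_eq_zero_iff hφ hφc hT hS, hf', map_add, d₁_d₀, add_zero]
    exact f.2
  refine ⟨Ext1.mk ρM ρN ⟨f', hz⟩, ?_⟩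
  rw [ext1Map_mk, ← sub_eq_zero, ← map_sub, Ext1.mk_eq_zero_iff]
  refine ⟨g, ?_⟩
  change _ = cochainMap φ ψT ψS f' - f.1
  rw [hf', add_sub_cancel_left]

/-- Transport of endomorphisms along `M ≃ P` over `D → C`. -/
noncomputable def endMap (hT : IsHomOver φ ρM ρP ψT.toLinearMap) (a : ρM.endAlgebra) :
    ρP.endAlgebra :=
  ⟨ψT.toLinearMap ∘ₗ a.1 ∘ₗ ψT.symm.toLinearMap, by
    -- An endomorphism is colinear exactly when `d₀` kills it, so the chain map property applies.
    refine sub_eq_zero.1 ((d₀_cochainMap hT hT a.1).trans ?_)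
    rw [show d₀ ρM ρM a.1 = 0 from sub_eq_zero.2 a.2, map_zero]⟩

/-- Injectivity of `cochainMap` reflects the equation `d₀ a = 0`, so every endomorphism over `C`
already is one over `D`. -/
theorem endMap_bijective (hφ : Function.Injective φ) (hT : IsHomOver φ ρM ρP ψT.toLinearMap) :
    Function.Bijective (endMap hT) := by
  constructor
  · intro a b h
    ext t
    have := LinearMap.congr_fun (congrArg Subtype.val h) (ψT t)
    simpa [endMap] using this
  · intro b
    have e : ψT.toLinearMap ∘ₗ (ψT.symm.toLinearMap ∘ₗ b.1 ∘ₗ ψT.toLinearMap) ∘ₗ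
        ψT.symm.toLinearMap = b.1 := by ext; simp
    refine ⟨⟨ψT.symm.toLinearMap ∘ₗ b.1 ∘ₗ ψT.toLinearMap, ?_⟩, Subtype.ext e⟩
    refine sub_eq_zero.1 (cochainMap_injective (ψT := ψT) (ψS := ψT) hφ
      (((d₀_cochainMap hT hT _).symm.trans ?_).trans (map_zero _).symm))
    rw [e]
    exact sub_eq_zero.2 b.2

/-- Semilinearity along `endMap`, which makes dimensions over two different endomorphism rings
comparable. -/
theorem ext1Map_smul_left (hφ : Function.Injective φ)
    (hφc : TensorProduct.map φ φ ∘ₗ Coalgebra.comul = Coalgebra.comul ∘ₗ φ)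
    (hT : IsHomOver φ ρM ρP ψT.toLinearMap) (hS : IsHomOver φ ρN ρQ ψS.toLinearMap)
    (b : ρN.endAlgebra) (x : Ext1 ρM ρN) :
    ext1Map hφ hφc hT hS (b • x) = endMap hS b • ext1Map hφ hφc hT hS x := by
  obtain ⟨f, rfl⟩ := Ext1.mk_surjective ρM ρN x
  refine congrArg (Ext1.mk ρP ρQ) (Subtype.ext ?_)
  change cochainMap φ ψT ψS (b.1.rTensor D ∘ₗ f.1) =
    (endMap hS b).1.rTensor C ∘ₗ cochainMap φ ψT ψS f.1
  have e : TensorProduct.map ψS.toLinearMap φ ∘ₗ b.1.rTensor D =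
      (endMap hS b).1.rTensor C ∘ₗ TensorProduct.map ψS.toLinearMap φ := by
    ext; simp [endMap]
  ext t
  obtain ⟨t, rfl⟩ := ψT.surjective t
  rw [cochainMap_apply, LinearMap.comp_apply, LinearMap.comp_apply, cochainMap_apply]
  exact LinearMap.congr_fun e (f.1 t)

theorem ext1Map_smul_right (hφ : Function.Injective φ)
    (hφc : TensorProduct.map φ φ ∘ₗ Coalgebra.comul = Coalgebra.comul ∘ₗ φ)
    (hT : IsHomOver φ ρM ρP ψT.toLinearMap) (hS : IsHomOver φ ρN ρQ ψS.toLinearMap)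
    (a : ρM.endAlgebraᵐᵒᵖ) (x : Ext1 ρM ρN) :
    ext1Map hφ hφc hT hS (a • x) =
      MulOpposite.op (endMap hT a.unop) • ext1Map hφ hφc hT hS x := by
  obtain ⟨f, rfl⟩ := Ext1.mk_surjective ρM ρN x
  refine congrArg (Ext1.mk ρP ρQ) (Subtype.ext ?_)
  change cochainMap φ ψT ψS (f.1 ∘ₗ a.unop.1) = cochainMap φ ψT ψS f.1 ∘ₗ (endMap hT a.unop).1
  ext t
  obtain ⟨t, rfl⟩ := ψT.surjective t
  rw [cochainMap_apply, LinearMap.comp_apply, LinearMap.comp_apply,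
    show (endMap hT a.unop).1 (ψT t) = ψT (a.unop.1 t) by simp [endMap], cochainMap_apply]

theorem endMap_op_bijective (hφ : Function.Injective φ)
    (hT : IsHomOver φ ρM ρP ψT.toLinearMap) :
    Function.Bijective (fun a : ρM.endAlgebraᵐᵒᵖ => MulOpposite.op (endMap hT a.unop)) :=
  MulOpposite.op_bijective.comp ((endMap_bijective hφ hT).comp MulOpposite.unop_bijective)

/-- Surjectivity of `endMap` as a map of scalars is enough, together with injectivity and
semilinearity on `Ext¹`; multiplicativity of `endMap` plays no part. -/
theorem rank_left_le (hφ : Function.Injective φ)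
    (hφc : TensorProduct.map φ φ ∘ₗ Coalgebra.comul = Coalgebra.comul ∘ₗ φ)
    (hT : IsHomOver φ ρM ρP ψT.toLinearMap) (hS : IsHomOver φ ρN ρQ ψS.toLinearMap) :
    Module.rank ρN.endAlgebra (Ext1 ρM ρN) ≤ Module.rank ρQ.endAlgebra (Ext1 ρP ρQ) :=
  rank_le_of_surjective_injective (endMap hS)
    (ext1Map hφ hφc hT hS).toAddMonoidHom (endMap_bijective hφ hS).2
    (ext1Map_injective hφ hφc hT hS) (ext1Map_smul_left hφ hφc hT hS)

theorem rank_right_le (hφ : Function.Injective φ)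
    (hφc : TensorProduct.map φ φ ∘ₗ Coalgebra.comul = Coalgebra.comul ∘ₗ φ)
    (hT : IsHomOver φ ρM ρP ψT.toLinearMap) (hS : IsHomOver φ ρN ρQ ψS.toLinearMap) :
    Module.rank ρM.endAlgebraᵐᵒᵖ (Ext1 ρM ρN) ≤ Module.rank ρP.endAlgebraᵐᵒᵖ (Ext1 ρP ρQ) :=
  rank_le_of_surjective_injective
    (fun a => MulOpposite.op (endMap hT a.unop))
    (ext1Map hφ hφc hT hS).toAddMonoidHom (endMap_op_bijective hφ hT).2
    (ext1Map_injective hφ hφc hT hS) (ext1Map_smul_right hφ hφc hT hS)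

theorem rank_left_eq (hφ : Function.Injective φ)
    (hφc : TensorProduct.map φ φ ∘ₗ Coalgebra.comul = Coalgebra.comul ∘ₗ φ)
    (hT : IsHomOver φ ρM ρP ψT.toLinearMap) (hS : IsHomOver φ ρN ρQ ψS.toLinearMap)
    (hs : Function.Surjective (ext1Map hφ hφc hT hS)) :
    Module.rank ρN.endAlgebra (Ext1 ρM ρN) = Module.rank ρQ.endAlgebra (Ext1 ρP ρQ) :=
  rank_eq_of_equiv_equiv (endMap hS)
    (AddEquiv.ofBijective (ext1Map hφ hφc hT hS).toAddMonoidHom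
      ⟨ext1Map_injective hφ hφc hT hS, hs⟩)
    (endMap_bijective hφ hS) (ext1Map_smul_left hφ hφc hT hS)

theorem rank_right_eq (hφ : Function.Injective φ)
    (hφc : TensorProduct.map φ φ ∘ₗ Coalgebra.comul = Coalgebra.comul ∘ₗ φ)
    (hT : IsHomOver φ ρM ρP ψT.toLinearMap) (hS : IsHomOver φ ρN ρQ ψS.toLinearMap)
    (hs : Function.Surjective (ext1Map hφ hφc hT hS)) :
    Module.rank ρM.endAlgebraᵐᵒᵖ (Ext1 ρM ρN) = Module.rank ρP.endAlgebraᵐᵒᵖ (Ext1 ρP ρQ) :=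
  rank_eq_of_equiv_equiv (fun a => MulOpposite.op (endMap hT a.unop))
    (AddEquiv.ofBijective (ext1Map hφ hφc hT hS).toAddMonoidHom
      ⟨ext1Map_injective hφ hφc hT hS, hs⟩)
    (endMap_op_bijective hφ hT) (ext1Map_smul_right hφ hφc hT hS)

end Cochains

theorem exists_arrow_map (φ : D →ₗc[k] C) (hφ : Function.Injective φ.toLinearMap)
    {T S : Submodule k D} {c d : Cardinal.{v}} (h : (gabrielQuiver k D).arrow T S c d) :
    ∃ c' d', c ≤ c' ∧ d ≤ d' ∧
      (gabrielQuiver k C).arrow (T.map φ.toLinearMap) (S.map φ.toLinearMap) c' d' := by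
  obtain ⟨hT, hS, sT, sS, hn, rfl, rfl⟩ := h
  have hT' := ((regular_isHomOver φ).isSubcomodule_map_iff hφ hφ T).2 hT
  have hS' := ((regular_isHomOver φ).isSubcomodule_map_iff hφ hφ S).2 hS
  have iT := restrict_isHomOver φ hφ T hT hT'
  have iS := restrict_isHomOver φ hφ S hS hS'
  refine ⟨_, _, rank_right_le hφ φ.map_comp_comul iT iS, rank_left_le hφ φ.map_comp_comul iT iS,
    hT', hS', (iT.isSimple_iff hφ).2 sT, (iS.isSimple_iff hφ).2 sS,
    (ext1Map_injective hφ φ.map_comp_comul iT iS).nontrivial, rfl, rfl⟩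

/-- The criterion behind (ii), (iii) and (iv): `H` makes the comparison of `Ext¹` bijective, so
nonvanishing and both dimensions agree. `H` is required only for simple comodules, so simplicity is
available when it is verified. -/
theorem arrow_map_iff (φ : D →ₗc[k] C) (hφ : Function.Injective φ.toLinearMap)
    (T S : Submodule k D) (c d : Cardinal.{v})
    (H : ∀ (hT : (regular k C).IsSubcomodule (T.map φ.toLinearMap))
      (hS : (regular k C).IsSubcomodule (S.map φ.toLinearMap)),
      ((regular k C).restrict _ hT).IsSimple → ((regular k C).restrict _ hS).IsSimple →
      ∀ f, d₁ ((regular k C).restrict _ hT) ((regular k C).restrict _ hS) f = 0 →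
        ∃ g, ∀ t, (LinearMap.range φ.toLinearMap).mkQ.lTensor _
          ((f + d₀ ((regular k C).restrict _ hT) ((regular k C).restrict _ hS) g) t) = 0) :
    (gabrielQuiver k C).arrow (T.map φ.toLinearMap) (S.map φ.toLinearMap) c d ↔
      (gabrielQuiver k D).arrow T S c d := by
  have hT := (regular_isHomOver φ).isSubcomodule_map_iff hφ hφ T
  have hS := (regular_isHomOver φ).isSubcomodule_map_iff hφ hφ S
  constructor
  · rintro ⟨hT', hS', sT', sS', hn, rfl, rfl⟩
    have iT := restrict_isHomOver φ hφ T (hT.1 hT') hT'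
    have iS := restrict_isHomOver φ hφ S (hS.1 hS') hS'
    have hs := ext1Map_surjective hφ φ.map_comp_comul iT iS (H hT' hS' sT' sS')
    exact ⟨hT.1 hT', hS.1 hS', (iT.isSimple_iff hφ).1 sT', (iS.isSimple_iff hφ).1 sS',
      hs.nontrivial, (rank_right_eq hφ φ.map_comp_comul iT iS hs).symm,
      (rank_left_eq hφ φ.map_comp_comul iT iS hs).symm⟩
  · rintro ⟨hT', hS', sT', sS', hn, rfl, rfl⟩
    have iT := restrict_isHomOver φ hφ T hT' (hT.2 hT')
    have iS := restrict_isHomOver φ hφ S hS' (hS.2 hS')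
    have sT := (iT.isSimple_iff hφ).2 sT'
    have sS := (iS.isSimple_iff hφ).2 sS'
    have hs := ext1Map_surjective hφ φ.map_comp_comul iT iS (H _ _ sT sS)
    exact ⟨hT.2 hT', hS.2 hS', sT, sS, (ext1Map_injective hφ φ.map_comp_comul iT iS).nontrivial,
      rank_right_eq hφ φ.map_comp_comul iT iS hs, rank_left_eq hφ φ.map_comp_comul iT iS hs⟩

end Transfer

end RightComodule

/-! ### The part of a comodule with coefficients in `A` -/

namespace RightComodule

section Coefficients

variable {k : Type u} {C M N : Type v} [Field k] [AddCommGroup C] [Module k C]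
  [AddCommGroup M] [Module k M] [AddCommGroup N] [Module k N]

/-- The elements `m` of `M` with `ρ m ∈ M ⊗ A`. -/
noncomputable def coeffPart (ρ : M →ₗ[k] M ⊗[k] C) (A : Submodule k C) : Submodule k M :=
  LinearMap.ker (A.mkQ.lTensor M ∘ₗ ρ)

theorem mem_coeffPart {ρ : M →ₗ[k] M ⊗[k] C} {A : Submodule k C} {m : M} :
    m ∈ coeffPart ρ A ↔ A.mkQ.lTensor M (ρ m) = 0 :=
  Iff.rfl

theorem lTensor_map_assoc {U V : Type*} [AddCommGroup U] [Module k U] [AddCommGroup V] [Module k V]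
    (p : C →ₗ[k] U) (q : C →ₗ[k] V) (x : (N ⊗[k] C) ⊗[k] C) :
    (TensorProduct.map p q).lTensor N (TensorProduct.assoc k N C C x) =
      TensorProduct.assoc k N U V (TensorProduct.map (p.lTensor N) q x) := by
  have e : (TensorProduct.map p q).lTensor N ∘ₗ (TensorProduct.assoc k N C C).toLinearMap =
      (TensorProduct.assoc k N U V).toLinearMap ∘ₗ TensorProduct.map (p.lTensor N) q := by
    ext; rfl
  exact LinearMap.congr_fun e x

theorem assoc_rTensor_rTensor {P Q : Type v} [AddCommGroup P] [Module k P] [AddCommGroup Q]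
    [Module k Q] (i : P →ₗ[k] Q) (x : (P ⊗[k] C) ⊗[k] C) :
    TensorProduct.assoc k Q C C ((i.rTensor C).rTensor C x) =
      i.rTensor (C ⊗[k] C) (TensorProduct.assoc k P C C x) := by
  have e : (TensorProduct.assoc k Q C C).toLinearMap ∘ₗ (i.rTensor C).rTensor C =
      i.rTensor (C ⊗[k] C) ∘ₗ (TensorProduct.assoc k P C C).toLinearMap := by
    ext; rfl
  exact LinearMap.congr_fun e x

variable [Coalgebra k C]

/-- By `hA`, that is `Δ(A) ⊆ A ⊗ C`, the map `(p ⊗ id) Δ` factors through `C/A`. -/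
theorem lTensor_comul_eq_zero (M : Type v) [AddCommGroup M] [Module k M] {A : Submodule k C}
    (hA : ∀ a ∈ A, A.mkQ.rTensor C (Coalgebra.comul (R := k) a) = 0) {x : M ⊗[k] C}
    (hx : A.mkQ.lTensor M x = 0) :
    (A.mkQ.rTensor C).lTensor M ((Coalgebra.comul (R := k) (A := C)).lTensor M x) = 0 := by
  let δ : C ⧸ A →ₗ[k] (C ⧸ A) ⊗[k] C := A.liftQ (A.mkQ.rTensor C ∘ₗ Coalgebra.comul) hA
  have hδ : δ ∘ₗ A.mkQ = A.mkQ.rTensor C ∘ₗ Coalgebra.comul := Submodule.liftQ_mkQ _ _ _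
  rw [← LinearMap.comp_apply, ← LinearMap.lTensor_comp, ← hδ, LinearMap.lTensor_comp,
    LinearMap.comp_apply, hx, map_zero]

/-- If `ρ m ∈ M ⊗ A`, then `(ρ ⊗ id) ρ m = (id ⊗ Δ) ρ m ∈ M ⊗ A ⊗ C`, so `ρ m` lies in the kernel of
`(id ⊗ p) ρ ⊗ id`, which is `M_A ⊗ C`. Only coassociativity enters, so that the result applies
directly to `extCoact`. -/
theorem coeffPart_coact_mem {ρ : M →ₗ[k] M ⊗[k] C}
    (hρ : (TensorProduct.assoc k M C C).toLinearMap ∘ₗ ρ.rTensor C ∘ₗ ρ =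
      (Coalgebra.comul (R := k) (A := C)).lTensor M ∘ₗ ρ) {A : Submodule k C}
    (hA : ∀ a ∈ A, A.mkQ.rTensor C (Coalgebra.comul (R := k) a) = 0) {m : M}
    (hm : m ∈ coeffPart ρ A) :
    ρ m ∈ LinearMap.range ((coeffPart ρ A).subtype.rTensor C) := by
  rw [mem_range_rTensor_subtype_iff]
  refine Subcoalgebra.rTensor_mkQ_eq_zero _ _ ?_
  apply (TensorProduct.assoc k M (C ⧸ A) C).injective
  have e : (TensorProduct.assoc k M (C ⧸ A) C).toLinearMap ∘ₗ (A.mkQ.lTensor M).rTensor C =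
      (A.mkQ.rTensor C).lTensor M ∘ₗ (TensorProduct.assoc k M C C).toLinearMap := by
    ext; rfl
  have h1 := LinearMap.congr_fun e (ρ.rTensor C (ρ m))
  have h2 := LinearMap.congr_fun hρ m
  simp only [LinearMap.comp_apply, LinearEquiv.coe_coe] at h1 h2
  rw [LinearMap.rTensor_comp, LinearMap.comp_apply, h1, h2, map_zero]
  exact lTensor_comul_eq_zero M hA hm

/-- If `C = A ∧ B` then `M / M_A` is a comodule over `B`. -/
theorem map_coeffPart_mkQ_eq_zero {ρ : M →ₗ[k] M ⊗[k] C}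
    (hρ : (TensorProduct.assoc k M C C).toLinearMap ∘ₗ ρ.rTensor C ∘ₗ ρ =
      (Coalgebra.comul (R := k) (A := C)).lTensor M ∘ₗ ρ) {A B : Submodule k C}
    (hAB : Subcoalgebra.wedgeSubmodule A B = ⊤) (m : M) :
    TensorProduct.map (coeffPart ρ A).mkQ B.mkQ (ρ m) = 0 := by
  have hAB' : TensorProduct.map A.mkQ B.mkQ ∘ₗ Coalgebra.comul (R := k) = 0 :=
    LinearMap.ker_eq_top.1 hAB
  rw [show TensorProduct.map (coeffPart ρ A).mkQ B.mkQ =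
    (coeffPart ρ A).mkQ.rTensor (C ⧸ B) ∘ₗ B.mkQ.lTensor M from
      (LinearMap.rTensor_comp_lTensor ..).symm, LinearMap.comp_apply]
  -- As `M_A` is the kernel of `(id ⊗ p) ρ`, it suffices that `(id ⊗ p) ρ ⊗ q` kills `ρ m`. By
  -- coassociativity the result is `(id ⊗ (p ⊗ q) Δ) ρ m`, which is zero because `C = A ∧ B`.
  refine Subcoalgebra.rTensor_mkQ_eq_zero _ _ ?_
  apply (TensorProduct.assoc k M (C ⧸ A) (C ⧸ B)).injective
  have e : (TensorProduct.assoc k M (C ⧸ A) (C ⧸ B)).toLinearMap ∘ₗ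
      (A.mkQ.lTensor M ∘ₗ ρ).rTensor (C ⧸ B) ∘ₗ B.mkQ.lTensor M =
      (TensorProduct.map A.mkQ B.mkQ).lTensor M ∘ₗ
        (TensorProduct.assoc k M C C).toLinearMap ∘ₗ ρ.rTensor C := by
    have e' : (TensorProduct.assoc k M (C ⧸ A) (C ⧸ B)).toLinearMap ∘ₗ
        (A.mkQ.lTensor M).rTensor (C ⧸ B) ∘ₗ B.mkQ.lTensor (M ⊗[k] C) =
        (TensorProduct.map A.mkQ B.mkQ).lTensor M ∘ₗ
          (TensorProduct.assoc k M C C).toLinearMap := by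
      ext; rfl
    rw [← LinearMap.comp_assoc _ _ ((TensorProduct.map A.mkQ B.mkQ).lTensor M), ← e',
      LinearMap.rTensor_comp, LinearMap.comp_assoc, LinearMap.comp_assoc, LinearMap.comp_assoc,
      LinearMap.rTensor_comp_lTensor, LinearMap.lTensor_comp_rTensor]
  have h1 := LinearMap.congr_fun e (ρ m)
  have h2 := LinearMap.congr_fun hρ m
  simp only [LinearMap.comp_apply, LinearEquiv.coe_coe] at h1 h2
  rw [map_zero]
  refine h1.trans ?_
  rw [h2, ← LinearMap.comp_apply, ← LinearMap.lTensor_comp, hAB', LinearMap.lTensor_zero,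
    LinearMap.zero_apply]

theorem coeffPart_isSubcomodule (ρ : RightComodule k C M) {A : Submodule k C}
    (hA : ∀ a ∈ A, A.mkQ.rTensor C (Coalgebra.comul (R := k) a) = 0) :
    ρ.IsSubcomodule (coeffPart ρ.coact A) :=
  fun _ hm => coeffPart_coact_mem ρ.coassoc hA hm

/-- The case `M_A = 0` of `map_coeffPart_mkQ_eq_zero`: then `M` itself is the quotient `M/M_A`. -/
theorem lTensor_mkQ_coact_of_coeffPart_eq_bot {ρ : M →ₗ[k] M ⊗[k] C}
    (hρ : (TensorProduct.assoc k M C C).toLinearMap ∘ₗ ρ.rTensor C ∘ₗ ρ =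
      (Coalgebra.comul (R := k) (A := C)).lTensor M ∘ₗ ρ) {A B : Submodule k C}
    (hAB : Subcoalgebra.wedgeSubmodule A B = ⊤) (h : coeffPart ρ A = ⊥) (m : M) :
    B.mkQ.lTensor M (ρ m) = 0 := by
  have inj : Function.Injective (coeffPart ρ A).mkQ := by
    rw [← LinearMap.ker_eq_bot, Submodule.ker_mkQ, h]
  apply Module.Flat.rTensor_preserves_injective_linearMap (M := C ⧸ B) _ inj
  rw [map_zero, ← map_coeffPart_mkQ_eq_zero hρ hAB m]
  exact LinearMap.congr_fun (LinearMap.rTensor_comp_lTensor ..) _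

/-- For a simple `S` which is not an `A`-comodule, `S → S ⊗ C/A` is injective. -/
theorem IsSimple.coeffPart_eq_bot {ρ : RightComodule k C M} (h : ρ.IsSimple) {A : Submodule k C}
    (hA : ∀ a ∈ A, A.mkQ.rTensor C (Coalgebra.comul (R := k) a) = 0)
    (hn : coeffPart ρ.coact A ≠ ⊤) : coeffPart ρ.coact A = ⊥ :=
  (h.2 _ (coeffPart_isSubcomodule ρ hA)).resolve_right hn

/-- Links inclusion of subspaces with coefficients. If `Δ(s) ∈ C ⊗ A`, applying the counit to the
left factor gives `s ∈ A`; the converse is `Δ(A) ⊆ C ⊗ A`. -/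
theorem coeffPart_restrict_regular_eq_top_iff {A : Submodule k C}
    (hA : ∀ a ∈ A, A.mkQ.lTensor C (Coalgebra.comul (R := k) a) = 0)
    {S : Submodule k C} (h : (regular k C).IsSubcomodule S) :
    coeffPart ((regular k C).restrict S h).coact A = ⊤ ↔ S ≤ A := by
  have key (s : S) : s ∈ coeffPart ((regular k C).restrict S h).coact A ↔
      A.mkQ.lTensor C (Coalgebra.comul (R := k) s.1) = 0 := by
    have e : S.subtype.rTensor (C ⧸ A) ∘ₗ A.mkQ.lTensor S =
        A.mkQ.lTensor C ∘ₗ S.subtype.rTensor C :=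
      (LinearMap.rTensor_comp_lTensor ..).trans (LinearMap.lTensor_comp_rTensor ..).symm
    have h1 := LinearMap.congr_fun e ((regular k C).subCoact S h s)
    have h2 : S.subtype.rTensor C ((regular k C).subCoact S h s) = Coalgebra.comul (R := k) s.1 :=
      LinearMap.congr_fun (subtype_comp_subCoact _ S h) s
    simp only [LinearMap.comp_apply, h2] at h1
    rw [mem_coeffPart, ← h1, map_eq_zero_iff _ (rTensor_subtype_injective (C ⧸ A) S)]
    rfl
  constructor
  · intro H s hs
    have h1 := (key ⟨s, hs⟩).1 (by rw [H]; trivial)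
    have e : (Coalgebra.counit (R := k) (A := C)).rTensor (C ⧸ A) ∘ₗ A.mkQ.lTensor C =
        A.mkQ.lTensor k ∘ₗ (Coalgebra.counit (R := k) (A := C)).rTensor C :=
      (LinearMap.rTensor_comp_lTensor ..).trans (LinearMap.lTensor_comp_rTensor ..).symm
    have h2 := LinearMap.congr_fun e (Coalgebra.comul (R := k) s)
    simp only [LinearMap.comp_apply, Coalgebra.rTensor_counit_comul, h1, map_zero,
      LinearMap.lTensor_tmul] at h2
    have h3 := congrArg (TensorProduct.lid k (C ⧸ A)) h2
    rw [map_zero, TensorProduct.lid_tmul, one_smul] at h3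
    exact (Submodule.Quotient.mk_eq_zero A).1 h3.symm
  · exact fun H => eq_top_iff.2 fun s _ => (key s).2 (hA _ (H s.2))

end Coefficients

/-! ### Cocycles and extensions over a wedge -/

section Extension

variable {k : Type u} {C M N : Type v} [Field k] [AddCommGroup C] [Module k C] [Coalgebra k C]
  [AddCommGroup M] [Module k M] [AddCommGroup N] [Module k N]
  {ρT : RightComodule k C M} {ρS : RightComodule k C N} {f : M →ₗ[k] N ⊗[k] C}
  {A B : Submodule k C}

theorem d₁_eq_zero_apply (hf : d₁ ρT ρS f = 0) (t : M) :
    (Coalgebra.comul (R := k) (A := C)).lTensor N (f t) =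
      TensorProduct.assoc k N C C (ρS.coact.rTensor C (f t)) +
      TensorProduct.assoc k N C C (f.rTensor C (ρT.coact t)) := by
  have := LinearMap.congr_fun hf t
  simp only [d₁, LinearMap.coe_mk, AddHom.coe_mk, LinearMap.sub_apply, LinearMap.add_apply,
    LinearMap.comp_apply, LinearEquiv.coe_coe, LinearMap.zero_apply] at this
  rw [← sub_eq_zero, ← neg_eq_zero, ← this]
  abel

theorem map_lTensor_rTensor_coact (hS : coeffPart ρS.coact A = ⊤) {V : Type*} [AddCommGroup V]
    [Module k V] (q : C →ₗ[k] V) (x : N ⊗[k] C) :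
    TensorProduct.map (A.mkQ.lTensor N) q (ρS.coact.rTensor C x) = 0 := by
  have h : A.mkQ.lTensor N ∘ₗ ρS.coact = 0 := LinearMap.ker_eq_top.1 hS
  rw [← LinearMap.comp_apply, LinearMap.map_comp_rTensor, h, TensorProduct.map_zero_left,
    LinearMap.zero_apply]

/-- An extension of a `B`-comodule by an `A`-comodule is an `A ∧ B`-comodule. -/
theorem lTensor_wedge_mkQ_cocycle (hf : d₁ ρT ρS f = 0) (hS : coeffPart ρS.coact A = ⊤)
    (hT : coeffPart ρT.coact B = ⊤) (t : M) :
    (Subcoalgebra.wedgeSubmodule A B).mkQ.lTensor N (f t) = 0 := by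
  -- `A ∧ B` is the kernel of `(p ⊗ q) Δ`, so apply `id ⊗ p ⊗ q` to the cocycle identity: `p` kills
  -- the term with `ρ_S`, and `q` the term with `ρ_T`.
  refine Subcoalgebra.lTensor_mkQ_eq_zero _ _ ?_
  have h : B.mkQ.lTensor M (ρT.coact t) = 0 := mem_coeffPart.1 (by rw [hT]; trivial)
  rw [LinearMap.lTensor_comp, LinearMap.comp_apply, d₁_eq_zero_apply hf, map_add,
    lTensor_map_assoc, lTensor_map_assoc, map_lTensor_rTensor_coact hS, map_zero, zero_add]
  have e : TensorProduct.map (A.mkQ.lTensor N) B.mkQ ∘ₗ f.rTensor C =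
      (A.mkQ.lTensor N ∘ₗ f).rTensor (C ⧸ B) ∘ₗ B.mkQ.lTensor M := by
    rw [LinearMap.map_comp_rTensor, LinearMap.rTensor_comp_lTensor]
  have h1 := LinearMap.congr_fun e (ρT.coact t)
  simp only [LinearMap.comp_apply, h, map_zero] at h1
  rw [h1, map_zero]

/-- Over `A ∧ B`, an extension of a simple comodule `T` by an `A`-comodule is an `A`-comodule
unless `T` is a `B`-comodule. -/
theorem lTensor_mkQ_cocycle_of_not_right (hf : d₁ ρT ρS f = 0) (sT : ρT.IsSimple)
    (hA : ∀ a ∈ A, A.mkQ.rTensor C (Coalgebra.comul (R := k) a) = 0)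
    (hAB : Subcoalgebra.wedgeSubmodule A B = ⊤) (hS : coeffPart ρS.coact A = ⊤)
    (hT : coeffPart ρT.coact B ≠ ⊤) (t : M) : A.mkQ.lTensor N (f t) = 0 := by
  have hAB' : TensorProduct.map A.mkQ B.mkQ ∘ₗ Coalgebra.comul (R := k) = 0 :=
    LinearMap.ker_eq_top.1 hAB
  -- The elements `t` with `f t ∈ S ⊗ A`. For these, `id ⊗ p ⊗ id` kills `(id ⊗ Δ) f t` and the term
  -- with `ρ_S`, hence also the term with `ρ_T`; so `W` is a subcomodule.
  let W : Submodule k M := LinearMap.ker (A.mkQ.lTensor N ∘ₗ f)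
  have hW : ρT.IsSubcomodule W := by
    intro t ht
    rw [mem_range_rTensor_subtype_iff]
    refine Subcoalgebra.rTensor_mkQ_eq_zero _ _ ?_
    have h := lTensor_comul_eq_zero N hA (x := f t) ht
    rw [d₁_eq_zero_apply hf, map_add, LinearMap.rTensor_def, lTensor_map_assoc,
      lTensor_map_assoc, map_lTensor_rTensor_coact hS, map_zero, zero_add,
      LinearEquiv.map_eq_zero_iff, ← LinearMap.comp_apply, LinearMap.map_comp_rTensor] at h
    exact h
  rcases sT.2 W hW with h | h
  · refine absurd (eq_top_iff.2 fun t _ => ?_) hT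
    rw [mem_coeffPart]
    apply Module.Flat.rTensor_preserves_injective_linearMap (M := C ⧸ B) _
      (LinearMap.ker_eq_bot.1 h)
    rw [map_zero]
    have h1 : (TensorProduct.map A.mkQ B.mkQ).lTensor N
        ((Coalgebra.comul (R := k) (A := C)).lTensor N (f t)) = 0 := by
      rw [← LinearMap.comp_apply, ← LinearMap.lTensor_comp, hAB', LinearMap.lTensor_zero,
        LinearMap.zero_apply]
    rw [d₁_eq_zero_apply hf, map_add, lTensor_map_assoc,
      lTensor_map_assoc, map_lTensor_rTensor_coact hS, map_zero, zero_add,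
      LinearEquiv.map_eq_zero_iff, ← LinearMap.comp_apply, LinearMap.map_comp_rTensor] at h1
    rw [← LinearMap.comp_apply, LinearMap.rTensor_comp_lTensor]
    exact h1
  · have : t ∈ W := by rw [h]; trivial
    exact this

/-- The coaction on `S × T` given by a cochain. -/
noncomputable def extCoact (ρT : RightComodule k C M) (ρS : RightComodule k C N)
    (f : M →ₗ[k] N ⊗[k] C) : N × M →ₗ[k] (N × M) ⊗[k] C :=
  (LinearMap.inl k N M).rTensor C ∘ₗ ρS.coact.coprod f +
    (LinearMap.inr k N M).rTensor C ∘ₗ ρT.coact ∘ₗ LinearMap.snd k N M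

theorem extCoact_inl : extCoact ρT ρS f ∘ₗ LinearMap.inl k N M =
    (LinearMap.inl k N M).rTensor C ∘ₗ ρS.coact := by
  ext; simp [extCoact]

theorem extCoact_inr : extCoact ρT ρS f ∘ₗ LinearMap.inr k N M =
    (LinearMap.inl k N M).rTensor C ∘ₗ f + (LinearMap.inr k N M).rTensor C ∘ₗ ρT.coact := by
  ext; simp [extCoact]

theorem rTensor_fst_extCoact :
    (LinearMap.fst k N M).rTensor C ∘ₗ extCoact ρT ρS f = ρS.coact.coprod f := by
  rw [extCoact, LinearMap.comp_add, ← LinearMap.comp_assoc, ← LinearMap.comp_assoc,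
    ← LinearMap.rTensor_comp, ← LinearMap.rTensor_comp, LinearMap.fst_comp_inl,
    LinearMap.fst_comp_inr, LinearMap.rTensor_id, LinearMap.rTensor_zero, LinearMap.zero_comp,
    LinearMap.id_comp, add_zero]

theorem rTensor_snd_extCoact :
    (LinearMap.snd k N M).rTensor C ∘ₗ extCoact ρT ρS f = ρT.coact ∘ₗ LinearMap.snd k N M := by
  rw [extCoact, LinearMap.comp_add, ← LinearMap.comp_assoc, ← LinearMap.comp_assoc,
    ← LinearMap.rTensor_comp, ← LinearMap.rTensor_comp, LinearMap.snd_comp_inl,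
    LinearMap.snd_comp_inr, LinearMap.rTensor_id, LinearMap.rTensor_zero, LinearMap.zero_comp,
    LinearMap.id_comp, zero_add]

theorem lTensor_comul_rTensor {P Q : Type v} [AddCommGroup P] [Module k P] [AddCommGroup Q]
    [Module k Q] (i : P →ₗ[k] Q) (x : P ⊗[k] C) :
    (Coalgebra.comul (R := k) (A := C)).lTensor Q (i.rTensor C x) =
      i.rTensor (C ⊗[k] C) ((Coalgebra.comul (R := k) (A := C)).lTensor P x) := by
  rw [← LinearMap.comp_apply, LinearMap.lTensor_comp_rTensor, ← LinearMap.rTensor_comp_lTensor,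
    LinearMap.comp_apply]

/-- On `S` this is the coassociativity of `ρ_S`; on `T` the component in `T` is that of `ρ_T` and
the component in `S` is exactly the cocycle identity. -/
theorem extCoact_coassoc (hf : d₁ ρT ρS f = 0) :
    (TensorProduct.assoc k (N × M) C C).toLinearMap ∘ₗ (extCoact ρT ρS f).rTensor C ∘ₗ
      extCoact ρT ρS f =
      (Coalgebra.comul (R := k) (A := C)).lTensor (N × M) ∘ₗ extCoact ρT ρS f := by
  have h1 (s : N) : extCoact ρT ρS f (LinearMap.inl k N M s) =
      (LinearMap.inl k N M).rTensor C (ρS.coact s) := LinearMap.congr_fun extCoact_inl s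
  have h2 (t : M) : extCoact ρT ρS f (LinearMap.inr k N M t) =
      (LinearMap.inl k N M).rTensor C (f t) + (LinearMap.inr k N M).rTensor C (ρT.coact t) :=
    LinearMap.congr_fun extCoact_inr t
  have h3 (x : N ⊗[k] C) : (extCoact ρT ρS f).rTensor C ((LinearMap.inl k N M).rTensor C x) =
      ((LinearMap.inl k N M).rTensor C).rTensor C (ρS.coact.rTensor C x) := by
    simp only [← LinearMap.comp_apply, ← LinearMap.rTensor_comp, extCoact_inl]
  have h4 (x : M ⊗[k] C) : (extCoact ρT ρS f).rTensor C ((LinearMap.inr k N M).rTensor C x) =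
      ((LinearMap.inl k N M).rTensor C).rTensor C (f.rTensor C x) +
      ((LinearMap.inr k N M).rTensor C).rTensor C (ρT.coact.rTensor C x) := by
    simp only [← LinearMap.comp_apply, ← LinearMap.rTensor_comp, extCoact_inr,
      LinearMap.rTensor_add, LinearMap.add_apply]
  have hS (s : N) := LinearMap.congr_fun ρS.coassoc s
  have hT (t : M) := LinearMap.congr_fun ρT.coassoc t
  simp only [LinearMap.comp_apply, LinearEquiv.coe_coe] at hS hT
  refine LinearMap.prod_ext (LinearMap.ext fun s => ?_) (LinearMap.ext fun t => ?_)
  · simp only [LinearMap.comp_apply, LinearEquiv.coe_coe, h1, h3, assoc_rTensor_rTensor, hS,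
      lTensor_comul_rTensor]
  · simp only [LinearMap.comp_apply, LinearEquiv.coe_coe, h2, h3, h4, assoc_rTensor_rTensor, hT,
      lTensor_comul_rTensor, map_add, d₁_eq_zero_apply hf]
    abel

/-- Over `A ∧ B`, an extension of a simple comodule `T` by a simple `S` which is not an
`A`-comodule splits or is a `B`-comodule. -/
theorem coboundary_or_lTensor_mkQ_eq_zero (hf : d₁ ρT ρS f = 0) (sT : ρT.IsSimple)
    (sS : ρS.IsSimple) (hA : ∀ a ∈ A, A.mkQ.rTensor C (Coalgebra.comul (R := k) a) = 0)
    (hAB : Subcoalgebra.wedgeSubmodule A B = ⊤) (hS : coeffPart ρS.coact A ≠ ⊤) :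
    (∃ g, f + d₀ ρT ρS g = 0) ∨
      (∀ t, B.mkQ.lTensor N (f t) = 0) ∧ coeffPart ρT.coact B = ⊤ := by
  have hS' := sS.coeffPart_eq_bot hA hS
  have hρ := extCoact_coassoc hf
  set ρ := extCoact ρT ρS f with hρdef
  set W := coeffPart ρ A with hW
  have comm {U V : Type v} [AddCommGroup U] [Module k U] [AddCommGroup V] [Module k V]
      (X : Submodule k C) (i : U →ₗ[k] V) (x : U ⊗[k] C) :
      X.mkQ.lTensor V (i.rTensor C x) = i.rTensor (C ⧸ X) (X.mkQ.lTensor U x) :=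
    LinearMap.congr_fun ((LinearMap.lTensor_comp_rTensor ..).trans
      (LinearMap.rTensor_comp_lTensor ..).symm) x
  have hfst (x : N × M) : (LinearMap.fst k N M).rTensor C (ρ x) = ρS.coact x.1 + f x.2 :=
    LinearMap.congr_fun rTensor_fst_extCoact x
  have hsnd (x : N × M) : (LinearMap.snd k N M).rTensor C (ρ x) = ρT.coact x.2 :=
    LinearMap.congr_fun rTensor_snd_extCoact x
  -- `W` meets `S` in zero because `S_A = 0`, so the projection to `T` is injective on `W`.
  have hker (x : N × M) (hx : x ∈ W) (h0 : x.2 = 0) : x = 0 := by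
    have h1 := comm A (LinearMap.fst k N M) (ρ x)
    rw [mem_coeffPart.1 hx, map_zero, hfst, h0, map_zero, add_zero] at h1
    have h2 : x.1 ∈ coeffPart ρS.coact A := h1
    rw [hS', Submodule.mem_bot] at h2
    exact Prod.ext h2 h0
  have hsub : ρT.IsSubcomodule (W.map (LinearMap.snd k N M)) := by
    rintro _ ⟨x, hx, rfl⟩
    obtain ⟨y, hy⟩ := coeffPart_coact_mem hρ hA hx
    refine ⟨((LinearMap.snd k N M).submoduleMap W).rTensor C y, ?_⟩
    rw [LinearMap.snd_apply, ← hsnd, ← hy]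
    simp only [← LinearMap.comp_apply, ← LinearMap.rTensor_comp]
    rfl
  rcases sT.2 _ hsub with h | h
  · right
    -- With `W = 0` the whole extension has coefficients in `B`. Its projections to `S` and `T` then
    -- give the two assertions.
    have hbot : W = ⊥ := by
      rw [eq_bot_iff]
      intro x hx
      have h1 : x.2 ∈ W.map (LinearMap.snd k N M) := ⟨x, hx, rfl⟩
      rw [h, Submodule.mem_bot] at h1
      exact hker x hx h1
    have key (x : N × M) := lTensor_mkQ_coact_of_coeffPart_eq_bot hρ hAB hbot x
    constructor
    · intro t
      have h1 := comm B (LinearMap.fst k N M) (ρ (0, t))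
      rwa [key, hfst, map_zero, map_zero, zero_add] at h1
    · refine eq_top_iff.2 fun t _ => ?_
      have h1 := comm B (LinearMap.snd k N M) (ρ (0, t))
      rwa [key, hsnd, map_zero] at h1
  · left
    let p : W →ₗ[k] M := LinearMap.snd k N M ∘ₗ W.subtype
    have hp : Function.Bijective p := by
      constructor
      · rw [injective_iff_map_eq_zero]
        exact fun x hx => Subtype.ext (hker x.1 x.2 hx)
      · intro t
        obtain ⟨x, hx, rfl⟩ : t ∈ W.map (LinearMap.snd k N M) := by rw [h]; trivial
        exact ⟨⟨x, hx⟩, rfl⟩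
    let e := LinearEquiv.ofBijective p hp
    -- `W` is now a complement of `S`, the graph of `g` over `T`. As `W` is stable under the
    -- coaction, comparing `S`-components gives `ρ_S g + f = (g ⊗ id) ρ_T`, that is, `f + d₀ g = 0`.
    let g : M →ₗ[k] N := LinearMap.fst k N M ∘ₗ W.subtype ∘ₗ e.symm.toLinearMap
    refine ⟨g, LinearMap.ext fun t => ?_⟩
    obtain ⟨w, rfl⟩ := e.surjective t
    obtain ⟨y, hy⟩ := coeffPart_coact_mem hρ hA w.2
    have hge : g ∘ₗ e.toLinearMap = LinearMap.fst k N M ∘ₗ W.subtype := by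
      ext x; simp [g]
    have h1 : ρT.coact (e w) = e.toLinearMap.rTensor C y := by
      refine (hsnd w.1).symm.trans ?_
      rw [← hy, ← LinearMap.comp_apply, ← LinearMap.rTensor_comp]
      rfl
    have h2 : ρS.coact (g (e w)) + f (e w) = (g ∘ₗ e.toLinearMap).rTensor C y := by
      have : g (e w) = w.1.1 := LinearMap.congr_fun hge w
      rw [this]
      refine (hfst w.1).symm.trans ?_
      rw [← hy, ← LinearMap.comp_apply, ← LinearMap.rTensor_comp, hge]
    simp only [d₀, LinearMap.coe_mk, AddHom.coe_mk, LinearMap.add_apply, LinearMap.sub_apply,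
      LinearMap.comp_apply, LinearMap.zero_apply, h1]
    have h3 : ρS.coact (g (e w)) + f (e w) = g.rTensor C (e.toLinearMap.rTensor C y) := by
      rw [h2, LinearMap.rTensor_comp, LinearMap.comp_apply]
    rw [← h3]
    abel

end Extension

end RightComodule

/-! ### Inclusions of subcoalgebras and vertices of their quivers -/

namespace Subcoalgebra

variable {k : Type u} {C D : Type v} [Field k] [AddCommGroup C] [Module k C] [Coalgebra k C]
  [AddCommGroup D] [Module k D] [Coalgebra k D]

open RightComodule

theorem rTensor_mkQ_comul_of_mem_range (φ : D →ₗc[k] C) (a : C)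
    (ha : a ∈ LinearMap.range φ.toLinearMap) :
    (LinearMap.range φ.toLinearMap).mkQ.rTensor C (Coalgebra.comul (R := k) a) = 0 := by
  obtain ⟨x, rfl⟩ := ha
  have h := LinearMap.congr_fun φ.map_comp_comul x
  simp only [LinearMap.comp_apply] at h
  rw [← h, ← LinearMap.comp_apply, LinearMap.rTensor_comp_map, LinearMap.range_mkQ_comp,
    TensorProduct.map_zero_left, LinearMap.zero_apply]

theorem lTensor_mkQ_comul_of_mem_range (φ : D →ₗc[k] C) (a : C)
    (ha : a ∈ LinearMap.range φ.toLinearMap) :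
    (LinearMap.range φ.toLinearMap).mkQ.lTensor C (Coalgebra.comul (R := k) a) = 0 := by
  obtain ⟨x, rfl⟩ := ha
  have h := LinearMap.congr_fun φ.map_comp_comul x
  simp only [LinearMap.comp_apply] at h
  rw [← h, ← LinearMap.comp_apply, LinearMap.lTensor_comp_map, LinearMap.range_mkQ_comp,
    TensorProduct.map_zero_right, LinearMap.zero_apply]

/-- The inclusion of a subcoalgebra. -/
noncomputable def subtypeHom (E : Subcoalgebra k C) : E.carrier →ₗc[k] C where
  toLinearMap := E.carrier.subtype
  counit_comp := rfl
  map_comp_comul := E.map_comp_subComul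

theorem subtypeHom_injective (E : Subcoalgebra k C) :
    Function.Injective E.subtypeHom.toLinearMap :=
  E.carrier.injective_subtype

/-- The inclusion between two subcoalgebras. -/
noncomputable def inclusionHom {E F : Subcoalgebra k C} (h : E.carrier ≤ F.carrier) :
    E.carrier →ₗc[k] F.carrier where
  toLinearMap := Submodule.inclusion h
  counit_comp := rfl
  map_comp_comul := by
    refine LinearMap.ext fun x => map_subtype_injective F.carrier F.carrier ?_
    have e : TensorProduct.map F.carrier.subtype F.carrier.subtype ∘ₗ
        TensorProduct.map (Submodule.inclusion h) (Submodule.inclusion h) =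
        TensorProduct.map E.carrier.subtype E.carrier.subtype := by
      ext; rfl
    exact (LinearMap.congr_fun e (E.subComul x)).trans
      ((LinearMap.congr_fun E.map_comp_subComul x).trans
        (LinearMap.congr_fun F.map_comp_subComul (Submodule.inclusion h x)).symm)

theorem inclusionHom_injective {E F : Subcoalgebra k C} (h : E.carrier ≤ F.carrier) :
    Function.Injective (inclusionHom h).toLinearMap :=
  Submodule.inclusion_injective h

theorem range_inclusionHom {E F : Subcoalgebra k C} (h : E.carrier ≤ F.carrier) :
    LinearMap.range (inclusionHom h).toLinearMap = E.carrier.comap F.carrier.subtype :=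
  Submodule.range_inclusion _ _ h

theorem left_le_wedge (A B : Subcoalgebra k C) : A.carrier ≤ (A.wedge B).carrier := by
  intro x hx
  change TensorProduct.map A.carrier.mkQ B.carrier.mkQ (Coalgebra.comul (R := k) x) = 0
  rw [← LinearMap.lTensor_comp_rTensor, LinearMap.comp_apply, A.rTensor_mkQ_comul hx, map_zero]

theorem right_le_wedge (A B : Subcoalgebra k C) : B.carrier ≤ (A.wedge B).carrier := by
  intro x hx
  change TensorProduct.map A.carrier.mkQ B.carrier.mkQ (Coalgebra.comul (R := k) x) = 0
  rw [← LinearMap.rTensor_comp_lTensor, LinearMap.comp_apply, B.lTensor_mkQ_comul hx, map_zero]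

/-- Inside `A ∧ B`, the wedge of `A` and `B` is everything. -/
theorem wedgeSubmodule_range_inclusionHom (A B : Subcoalgebra k C) :
    wedgeSubmodule (LinearMap.range (inclusionHom (left_le_wedge A B)).toLinearMap)
      (LinearMap.range (inclusionHom (right_le_wedge A B)).toLinearMap) = ⊤ := by
  rw [range_inclusionHom, range_inclusionHom]
  set F := A.wedge B with hF
  let i := F.carrier.subtype
  -- With `F = A ∧ B`, the quotient `F/(X ∩ F)` embeds in `C/X`. Vanishing can therefore be tested
  -- in `C/A ⊗ C/B`, where it is the definition of the wedge.
  have inj (X : Submodule k C) :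
      Function.Injective ((X.comap i).mapQ X i le_rfl) := by
    rw [← LinearMap.ker_eq_bot, Submodule.ker_mapQ, Submodule.mkQ_map_self]
  refine eq_top_iff.2 fun x _ => ?_
  refine TensorProduct.map_injective_of_flat_flat _ _ (inj A.carrier) (inj B.carrier) ?_
  rw [map_zero]
  have e : TensorProduct.map ((A.carrier.comap i).mapQ A.carrier i le_rfl)
      ((B.carrier.comap i).mapQ B.carrier i le_rfl) ∘ₗ
      TensorProduct.map (A.carrier.comap i).mkQ (B.carrier.comap i).mkQ =
      TensorProduct.map A.carrier.mkQ B.carrier.mkQ ∘ₗ TensorProduct.map i i := by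
    ext; rfl
  have hx : TensorProduct.map A.carrier.mkQ B.carrier.mkQ (Coalgebra.comul (R := k) x.1) = 0 := x.2
  refine (LinearMap.congr_fun e (F.subComul x)).trans (Eq.trans ?_ hx)
  exact congrArg _ (LinearMap.congr_fun F.map_comp_subComul x)

theorem mem_quiver_vertices_iff (E : Subcoalgebra k C) (S : Submodule k C) :
    S ∈ E.quiver.vertices ↔ IsSimpleSubcomodule k C S ∧ S ≤ E.carrier := by
  constructor
  · rintro ⟨S, hS, rfl⟩
    exact ⟨(isSimpleSubcomodule_map_iff E.subtypeHom E.subtypeHom_injective S).2 hS,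
      Submodule.map_subtype_le _ _⟩
  · rintro ⟨hS, hle⟩
    have e : (S.comap E.carrier.subtype).map E.carrier.subtype = S := by
      rw [Submodule.map_comap_subtype, inf_eq_right.2 hle]
    refine ⟨S.comap E.carrier.subtype, ?_, e⟩
    refine (isSimpleSubcomodule_map_iff E.subtypeHom E.subtypeHom_injective _).1 ?_
    exact e.symm ▸ hS

theorem quiver_arrow_map_iff (E : Subcoalgebra k C) (T S : Submodule k E.carrier)
    (c d : Cardinal.{v}) :
    E.quiver.arrow (T.map E.carrier.subtype) (S.map E.carrier.subtype) c d ↔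
      (gabrielQuiver k E.carrier).arrow T S c d := by
  have inj := Submodule.map_injective_of_injective E.carrier.injective_subtype
  constructor
  · rintro ⟨T', S', hT, hS, h⟩
    rwa [inj hT, inj hS] at h
  · exact fun h => ⟨T, S, rfl, rfl, h⟩

theorem exists_map_inclusionHom {E F : Subcoalgebra k C} (h : E.carrier ≤ F.carrier)
    {S : Submodule k F.carrier} (hS : S ≤ LinearMap.range (inclusionHom h).toLinearMap) :
    ∃ S', S = Submodule.map (inclusionHom h).toLinearMap S' :=
  ⟨S.comap (inclusionHom h).toLinearMap, by rw [Submodule.map_comap_eq, inf_eq_right.2 hS]⟩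

theorem map_subtype_map_inclusionHom {E F : Subcoalgebra k C} (h : E.carrier ≤ F.carrier)
    (S : Submodule k E.carrier) :
    (S.map (inclusionHom h).toLinearMap).map F.carrier.subtype = S.map E.carrier.subtype := by
  rw [← Submodule.map_comp]
  rfl

/-- Arrows in `Q_E` and in `Q_F`, for `E ⊆ F`, agree if all `F`-extensions come from `E`. -/
theorem quiver_arrow_iff_of_le {E F : Subcoalgebra k C} (h : E.carrier ≤ F.carrier)
    {T S : Submodule k F.carrier} (hTE : T ≤ LinearMap.range (inclusionHom h).toLinearMap)
    (hSE : S ≤ LinearMap.range (inclusionHom h).toLinearMap) (c d : Cardinal.{v})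
    (H : ∀ (hT : (regular k F.carrier).IsSubcomodule T)
      (hS : (regular k F.carrier).IsSubcomodule S),
      ((regular k F.carrier).restrict T hT).IsSimple →
      ((regular k F.carrier).restrict S hS).IsSimple →
      ∀ f, d₁ ((regular k F.carrier).restrict T hT) ((regular k F.carrier).restrict S hS) f = 0 →
        ∃ g, ∀ t, (LinearMap.range (inclusionHom h).toLinearMap).mkQ.lTensor _
          ((f + d₀ ((regular k F.carrier).restrict T hT)
            ((regular k F.carrier).restrict S hS) g) t) = 0) :
    F.quiver.arrow (T.map F.carrier.subtype) (S.map F.carrier.subtype) c d ↔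
      E.quiver.arrow (T.map F.carrier.subtype) (S.map F.carrier.subtype) c d := by
  obtain ⟨T, rfl⟩ := exists_map_inclusionHom h hTE
  obtain ⟨S, rfl⟩ := exists_map_inclusionHom h hSE
  rw [quiver_arrow_map_iff, map_subtype_map_inclusionHom, map_subtype_map_inclusionHom,
    quiver_arrow_map_iff]
  exact arrow_map_iff (inclusionHom h) (inclusionHom_injective h) T S c d H

theorem le_range_inclusionHom_iff {E F : Subcoalgebra k C} (h : E.carrier ≤ F.carrier)
    (S : Submodule k F.carrier) :
    S ≤ LinearMap.range (inclusionHom h).toLinearMap ↔ S.map F.carrier.subtype ≤ E.carrier := by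
  rw [range_inclusionHom, Submodule.map_le_iff_le_comap]

theorem coeffPart_inclusionHom_eq_top_iff {E F : Subcoalgebra k C} (h : E.carrier ≤ F.carrier)
    {S : Submodule k F.carrier} (hS : (regular k F.carrier).IsSubcomodule S) :
    coeffPart ((regular k F.carrier).restrict S hS).coact
      (LinearMap.range (inclusionHom h).toLinearMap) = ⊤ ↔
      S.map F.carrier.subtype ≤ E.carrier :=
  (coeffPart_restrict_regular_eq_top_iff (lTensor_mkQ_comul_of_mem_range (inclusionHom h)) hS).trans
    (le_range_inclusionHom_iff h S)

/-- By simplicity `S_A` is `S` or `0`; in the second case `S` has coefficients in `B`. -/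
theorem le_or_le_of_simple_wedge (A B : Subcoalgebra k C) {S : Submodule k (A.wedge B).carrier}
    (hS : IsSimpleSubcomodule k (A.wedge B).carrier S) :
    S.map (A.wedge B).carrier.subtype ≤ A.carrier ∨
      S.map (A.wedge B).carrier.subtype ≤ B.carrier := by
  obtain ⟨h, hs⟩ := hS
  refine or_iff_not_imp_left.2 fun hA => ?_
  rw [← coeffPart_inclusionHom_eq_top_iff (left_le_wedge A B) h] at hA
  rw [← coeffPart_inclusionHom_eq_top_iff (right_le_wedge A B) h]
  exact eq_top_iff.2 fun s _ => lTensor_mkQ_coact_of_coeffPart_eq_bot (RightComodule.coassoc _)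
    (wedgeSubmodule_range_inclusionHom A B)
    (hs.coeffPart_eq_bot (rTensor_mkQ_comul_of_mem_range _) hA) s

theorem quiver_wedge_vertices (A B : Subcoalgebra k C) :
    (A.wedge B).quiver.vertices = A.quiver.vertices ∪ B.quiver.vertices := by
  refine Set.Subset.antisymm ?_ (Set.union_subset ?_ ?_)
  · rintro S hS
    have hS' := ((mem_quiver_vertices_iff _ S).1 hS).1
    obtain ⟨S', h', rfl⟩ := hS
    exact (le_or_le_of_simple_wedge A B h').imp
      (fun h => (mem_quiver_vertices_iff A _).2 ⟨hS', h⟩)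
      (fun h => (mem_quiver_vertices_iff B _).2 ⟨hS', h⟩)
  · intro S hS
    rw [mem_quiver_vertices_iff] at hS ⊢
    exact ⟨hS.1, hS.2.trans (left_le_wedge A B)⟩
  · intro S hS
    rw [mem_quiver_vertices_iff] at hS ⊢
    exact ⟨hS.1, hS.2.trans (right_le_wedge A B)⟩

theorem quiver_vertices_subset (E : Subcoalgebra k C) :
    E.quiver.vertices ⊆ (gabrielQuiver k C).vertices :=
  fun S hS => ((mem_quiver_vertices_iff E S).1 hS).1

theorem exists_arrow_of_quiver_arrow (E : Subcoalgebra k C) {T S : Submodule k C}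
    {c d : Cardinal.{v}} (h : E.quiver.arrow T S c d) :
    ∃ c' d', c ≤ c' ∧ d ≤ d' ∧ (gabrielQuiver k C).arrow T S c' d' := by
  obtain ⟨T, S, rfl, rfl, h⟩ := h
  exact exists_arrow_map E.subtypeHom E.subtypeHom_injective h

/-! ### The four cases for arrows in the quiver of `A ∧ B` -/

variable (A B : Subcoalgebra k C) (T S : Submodule k (A.wedge B).carrier) (c d : Cardinal.{v})

theorem not_quiver_wedge_arrow (hSA : ¬ S.map (A.wedge B).carrier.subtype ≤ A.carrier)
    (hTB : ¬ T.map (A.wedge B).carrier.subtype ≤ B.carrier) :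
    ¬ (A.wedge B).quiver.arrow (T.map (A.wedge B).carrier.subtype)
      (S.map (A.wedge B).carrier.subtype) c d := by
  rw [quiver_arrow_map_iff]
  rintro ⟨hT, hS, sT, sS, hn, -, -⟩
  rw [← coeffPart_inclusionHom_eq_top_iff (left_le_wedge A B) hS] at hSA
  rw [← coeffPart_inclusionHom_eq_top_iff (right_le_wedge A B) hT] at hTB
  obtain ⟨x, hx⟩ := exists_ne (0 : Ext1 ((regular k _).restrict T hT) ((regular k _).restrict S hS))
  obtain ⟨f, rfl⟩ := Ext1.mk_surjective _ _ x
  -- A non-split extension would make `T` a `B`-comodule, which `hTB` excludes.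
  obtain ⟨g, hg⟩ := (coboundary_or_lTensor_mkQ_eq_zero f.2 sT sS
    (rTensor_mkQ_comul_of_mem_range _) (wedgeSubmodule_range_inclusionHom A B) hSA).resolve_right
      (fun h => hTB h.2)
  exact hx (Ext1.mk_eq_zero_of_add_d₀ f hg)

theorem quiver_wedge_arrow_iff (hSA : S.map (A.wedge B).carrier.subtype ≤ A.carrier)
    (hTB : T.map (A.wedge B).carrier.subtype ≤ B.carrier) :
    (A.wedge B).quiver.arrow (T.map (A.wedge B).carrier.subtype)
      (S.map (A.wedge B).carrier.subtype) c d ↔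
    (gabrielQuiver k C).arrow (T.map (A.wedge B).carrier.subtype)
      (S.map (A.wedge B).carrier.subtype) c d := by
  rw [quiver_arrow_map_iff]
  refine (arrow_map_iff (A.wedge B).subtypeHom (A.wedge B).subtypeHom_injective T S c d ?_).symm
  intro hT hS _ _ f hf
  refine ⟨0, fun t => ?_⟩
  have hr : LinearMap.range (A.wedge B).subtypeHom.toLinearMap =
      wedgeSubmodule A.carrier B.carrier := Submodule.range_subtype _
  rw [map_zero, add_zero, hr]
  exact lTensor_wedge_mkQ_cocycle hf
    ((coeffPart_restrict_regular_eq_top_iff (fun _ => A.lTensor_mkQ_comul) hS).2 hSA)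
    ((coeffPart_restrict_regular_eq_top_iff (fun _ => B.lTensor_mkQ_comul) hT).2 hTB) t

theorem quiver_wedge_arrow_iff_left (hTs : IsSimpleSubcomodule k (A.wedge B).carrier T)
    (hSA : S.map (A.wedge B).carrier.subtype ≤ A.carrier)
    (hTB : ¬ T.map (A.wedge B).carrier.subtype ≤ B.carrier) :
    (A.wedge B).quiver.arrow (T.map (A.wedge B).carrier.subtype)
      (S.map (A.wedge B).carrier.subtype) c d ↔
    A.quiver.arrow (T.map (A.wedge B).carrier.subtype)
      (S.map (A.wedge B).carrier.subtype) c d := by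
  -- Needed for `T` to be a comodule over `A` at all.
  have hTA := (le_or_le_of_simple_wedge A B hTs).resolve_right hTB
  refine quiver_arrow_iff_of_le (left_le_wedge A B) ((le_range_inclusionHom_iff _ _).2 hTA)
    ((le_range_inclusionHom_iff _ _).2 hSA) c d ?_
  intro hT hS sT _ f hf
  refine ⟨0, fun t => ?_⟩
  rw [map_zero, add_zero]
  exact lTensor_mkQ_cocycle_of_not_right hf sT (rTensor_mkQ_comul_of_mem_range _)
    (wedgeSubmodule_range_inclusionHom A B) ((coeffPart_inclusionHom_eq_top_iff _ hS).2 hSA)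
    (fun h => hTB ((coeffPart_inclusionHom_eq_top_iff _ hT).1 h)) t

theorem quiver_wedge_arrow_iff_right (hSs : IsSimpleSubcomodule k (A.wedge B).carrier S)
    (hSA : ¬ S.map (A.wedge B).carrier.subtype ≤ A.carrier)
    (hTB : T.map (A.wedge B).carrier.subtype ≤ B.carrier) :
    (A.wedge B).quiver.arrow (T.map (A.wedge B).carrier.subtype)
      (S.map (A.wedge B).carrier.subtype) c d ↔
    B.quiver.arrow (T.map (A.wedge B).carrier.subtype)
      (S.map (A.wedge B).carrier.subtype) c d := by
  have hSB := (le_or_le_of_simple_wedge A B hSs).resolve_left hSA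
  refine quiver_arrow_iff_of_le (right_le_wedge A B) ((le_range_inclusionHom_iff _ _).2 hTB)
    ((le_range_inclusionHom_iff _ _).2 hSB) c d ?_
  intro hT hS sT sS f hf
  rcases coboundary_or_lTensor_mkQ_eq_zero hf sT sS (rTensor_mkQ_comul_of_mem_range _)
    (wedgeSubmodule_range_inclusionHom A B)
    (fun h => hSA ((coeffPart_inclusionHom_eq_top_iff _ hS).1 h)) with ⟨g, hg⟩ | h
  -- A split extension need not have its cocycle in `S ⊗ B`; this is the one case where a coboundary
  -- correction is used.
  · exact ⟨g, fun t => by rw [hg, LinearMap.zero_apply, map_zero]⟩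
  · exact ⟨0, fun t => by rw [map_zero, add_zero]; exact h.1 t⟩

end Subcoalgebra

theorem mainTheorem4 {k : Type u} {C : Type v} [Field k] [AddCommGroup C] [Module k C]
    [Coalgebra k C] (hC : IsBasicCoalgebra k C) (A B : Subcoalgebra k C) :
    (A.wedge B).quiver.vertices = A.quiver.vertices ∪ B.quiver.vertices ∧
    (∀ E : Subcoalgebra k C, E = A ∨ E = B →
      E.quiver.vertices ⊆ (gabrielQuiver k C).vertices ∧
      ∀ T S c d, E.quiver.arrow T S c d →
        ∃ c' d', c ≤ c' ∧ d ≤ d' ∧ (gabrielQuiver k C).arrow T S c' d') ∧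
    ∀ S ∈ (A.wedge B).quiver.vertices, ∀ T ∈ (A.wedge B).quiver.vertices,
      (¬ S ≤ A.carrier → ¬ T ≤ B.carrier → ∀ c d, ¬ (A.wedge B).quiver.arrow T S c d) ∧
      (S ≤ A.carrier → T ≤ B.carrier → ∀ c d,
        (A.wedge B).quiver.arrow T S c d ↔ (gabrielQuiver k C).arrow T S c d) ∧
      (S ≤ A.carrier → ¬ T ≤ B.carrier → ∀ c d,
        (A.wedge B).quiver.arrow T S c d ↔ A.quiver.arrow T S c d) ∧
      (¬ S ≤ A.carrier → T ≤ B.carrier → ∀ c d,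
        (A.wedge B).quiver.arrow T S c d ↔ B.quiver.arrow T S c d) := by
  refine ⟨A.quiver_wedge_vertices B, fun E _ => ⟨E.quiver_vertices_subset,
    fun T S c d => E.exists_arrow_of_quiver_arrow⟩, ?_⟩
  rintro _ ⟨S, hS, rfl⟩ _ ⟨T, hT, rfl⟩
  exact ⟨fun hA hB c d => A.not_quiver_wedge_arrow B T S c d hA hB,
    fun hA hB c d => A.quiver_wedge_arrow_iff B T S c d hA hB,
    fun hA hB c d => A.quiver_wedge_arrow_iff_left B T S c d hT hA hB,
    fun hA hB c d => A.quiver_wedge_arrow_iff_right B T S c d hS hA hB⟩
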